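/- Automata are $\varepsilon$-free nondeterministic finite automata over finite non-empty alphabets. The size $|\mathcal A|$ of an automaton $\mathcal A$ is its number of states, and its state complexity $\mathrm{sc}(\mathcal A)$ is the number of states of a minimal complete deterministic automaton that recognizes the same language. Automata are given as inputs by an explicit list of their initial states, accepting states and transitions, coded as a binary word. Let $p$ be a polynomial that maps $\mathbb N$ to $\mathbb N$ and satisfies $p(i) \ge i$ for all $i \in \mathbb N$. A number $\widehat m \in \mathbb N$ is a $p$-approximation of the state complexity of $\mathcal A$ if $\mathrm{sc}(\mathcal A) \le \widehat m \le p(\mathrm{sc}(\mathcal A) + |\mathcal A|)$. Proposition. For every such $p$: 1. It is $\mathsf{PSPACE}$-hard to compute a $p$-approximation of the state complexity of a given automaton. That is, for every language $L \subseteq \{0,1\}^*$ in $\mathsf{PSPACE}$ there are a polynomial-time computable map $r$ from words to automata and a polynomial-time computable predicate $g$ such that, for every word $x$ and every $p$-approximation $\widehat m$ of the state complexity of $r(x)$, one has $x \in L$ if and only if $g(x, \widehat m)$ holds, where $\widehat m$ is given to $g$ in binary. 2. It is $\mathsf{PSPACE}$-hard (under polynomial-time many-one reductions) to decide, for a given automaton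 $\mathcal A$, whether a $p$-blow-up occurs, i.e. whether $\mathrm{sc}(\mathcal A) > p(|\mathcal A|)$. -/

import Mathlib

/-! ### Deterministic single-tape Turing machines and polynomial space -/

/-- A deterministic single-tape Turing machine with input alphabet `{0,1} = Bool`.
The embedding `sym` places the two input letters (`some b`) and the blank symbol (`none`) in the
tape alphabet. The machine halts exactly when it is in the state `accept` or `reject`. -/
structure SpaceTM where
  State : Type
  Symbol : Type
  [stateFintype : Fintype State]
  [symbolFintype : Fintype Symbol]
  sym : Option Bool ↪ Symbol
  start : State
  accept : State
  reject : State
  accept_ne_reject : accept ≠ reject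
  trans : State → Symbol → State × Symbol × Turing.Dir

namespace SpaceTM

/-- A configuration: control state, head position and contents of the tape, which is infinite to
the right and has its leftmost cell at position `0`. -/
structure Cfg (M : SpaceTM) where
  state : M.State
  head : ℕ
  tape : ℕ → M.Symbol

/-- The initial configuration: the input is in the leftmost cells, all other cells are blank, and
the head is on the leftmost cell. -/
def init (M : SpaceTM) (x : List Bool) : M.Cfg where
  state := M.start
  head := 0
  tape i := M.sym x[i]?

/-- The new head position. A left move on the leftmost cell leaves the head there. -/
def moveHead (h : ℕ) : Turing.Dir → ℕ
  | Turing.Dir.left => h - 1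
  | Turing.Dir.right => h + 1

open Classical in
/-- One step of the machine. Halting configurations do not change. -/
noncomputable def step (M : SpaceTM) (c : M.Cfg) : M.Cfg :=
  if c.state = M.accept ∨ c.state = M.reject then c
  else
    { state := (M.trans c.state (c.tape c.head)).1
      head := moveHead c.head (M.trans c.state (c.tape c.head)).2.2
      tape := Function.update c.tape c.head (M.trans c.state (c.tape c.head)).2.1 }

/-- The configuration on input `x` after `t` steps. -/
noncomputable def run (M : SpaceTM) (x : List Bool) (t : ℕ) : M.Cfg :=
  M.step^[t] (M.init x)

/-- `M` decides `L` in space `s`: on every input `x` it halts, it accepts if `x ∈ L` and rejects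
if `x ∉ L`, and it scans at most the first `s |x|` cells of the tape. -/
def DecidesInSpace (M : SpaceTM) (L : Language Bool) (s : ℕ → ℕ) : Prop :=
  ∀ x : List Bool,
    (x ∈ L → ∃ t, (M.run x t).state = M.accept) ∧
    (x ∉ L → ∃ t, (M.run x t).state = M.reject) ∧
    ∀ t, (M.run x t).head < s x.length

end SpaceTM

/-- The complexity class PSPACE: the languages over `{0,1}` that are decided by a deterministic
Turing machine in polynomial space. -/
def InPSPACE (L : Language Bool) : Prop :=
  ∃ (M : SpaceTM) (s : Polynomial ℕ), M.DecidesInSpace L fun n => s.eval n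

/-! ### Hardness for PSPACE -/

/-- The encoding of a pair of a binary word and a natural number (in binary), as a word over
`{0,1}` and a separator (`none`). -/
def encodeWordNat (a : List Bool × ℕ) : List (Option Bool) :=
  a.1.map some ++ none :: (Computability.encodeNat a.2).map some

/-- PSPACE-hardness of a decision problem, given by the set `P` of its yes-instances: every
language in PSPACE has a polynomial-time many-one reduction to it. -/
def PSPACEHardToDecide {α : Type} (enc : α → List Bool) (P : α → Prop) : Prop :=
  ∀ L : Language Bool, InPSPACE L →
    ∃ r : List Bool → α,
      Nonempty (Turing.TM2ComputableInPolyTime (id : List Bool → List Bool) enc r) ∧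
      ∀ x : List Bool, x ∈ L ↔ P (r x)

/-- PSPACE-hardness of the problem to compute, for an instance `a`, some number `m` with `R a m`:
for every language `L` in PSPACE there are a polynomial-time map `r` from words to instances and a
polynomial-time procedure `g` that decides `x ∈ L` from `x` and any solution `m` of the
instance `r x` whatsoever. -/
def PSPACEHardToCompute {α : Type} (enc : α → List Bool) (R : α → ℕ → Prop) : Prop :=
  ∀ L : Language Bool, InPSPACE L →
    ∃ (r : List Bool → α) (g : List Bool × ℕ → Bool),
      Nonempty (Turing.TM2ComputableInPolyTime (id : List Bool → List Bool) enc r) ∧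
      Nonempty (Turing.TM2ComputableInPolyTime encodeWordNat Computability.encodeBool g) ∧
      ∀ (x : List Bool) (m : ℕ), R (r x) m → (x ∈ L ↔ g (x, m) = true)

/-! ### Finite-state automata -/

/-- An `ε`-free finite-state automaton, as a finite object that can be the input of an algorithm:
the alphabet is `{0, …, letters - 1}`, the set of states is `{0, …, states - 1}`, and the initial
states, the accepting states and the transitions `(q, w, q')` are listed. The order and the
multiplicities in these lists are immaterial. -/
structure FSA where
  letters : ℕ
  letters_pos : 0 < letters
  states : ℕ
  initial : List (Fin states)
  final : List (Fin states)
  trans : List (Fin states × Fin letters × Fin states)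

namespace FSA

/-- The automaton as an `NFA` of Mathlib. -/
def toNFA (A : FSA) : NFA (Fin A.letters) (Fin A.states) where
  step q w := {q' | (q, w, q') ∈ A.trans}
  start := {q | q ∈ A.initial}
  accept := {q | q ∈ A.final}

/-- The language that the automaton recognizes. -/
def language (A : FSA) : Language (Fin A.letters) :=
  A.toNFA.accepts

/-- The number of states in a minimal equivalent (complete) deterministic automaton. -/
noncomputable def stateComplexity (A : FSA) : ℕ :=
  sInf {m : ℕ | ∃ D : DFA (Fin A.letters) (Fin m), D.accepts = A.language}

/-- The minimum in the definition of the state complexity is attained. -/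
theorem isLeast_stateComplexity (A : FSA) :
    IsLeast {m : ℕ | ∃ D : DFA (Fin A.letters) (Fin m), D.accepts = A.language}
      A.stateComplexity := by
  classical
  have hne : {m : ℕ | ∃ D : DFA (Fin A.letters) (Fin m), D.accepts = A.language}.Nonempty := by
    refine ⟨Fintype.card (Set (Fin A.states)),
      DFA.reindex (Fintype.equivFin (Set (Fin A.states))) A.toNFA.toDFA, ?_⟩
    rw [DFA.accepts_reindex, NFA.toDFA_correct]
    rfl
  exact ⟨Nat.sInf_mem hne, fun m hm => Nat.sInf_le hm⟩

/-- The self-delimiting unary code `1 ⋯ 1 0` of a natural number. -/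
def encodeUnary (n : ℕ) : List Bool :=
  List.replicate n true ++ [false]

/-- The code of a state or a letter. -/
def encodeFin {n : ℕ} (q : Fin n) : List Bool :=
  encodeUnary (q : ℕ)

/-- The code of a list: each entry is announced by a `1`, and a `0` marks the end. -/
def encodeList {β : Type} (e : β → List Bool) (l : List β) : List Bool :=
  l.flatMap (fun b => true :: e b) ++ [false]

/-- The code of a transition. -/
def encodeTransition {k n : ℕ} (t : Fin n × Fin k × Fin n) : List Bool :=
  encodeFin t.1 ++ encodeFin t.2.1 ++ encodeFin t.2.2

/-- The code of an automaton as a binary word. -/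
def encode (A : FSA) : List Bool :=
  encodeUnary A.letters ++ encodeUnary A.states ++
    encodeList encodeFin A.initial ++
    encodeList encodeFin A.final ++
    encodeList encodeTransition A.trans

theorem encodeUnary_append_inj {m n : ℕ} {s t : List Bool}
    (h : encodeUnary m ++ s = encodeUnary n ++ t) : m = n ∧ s = t := by
  induction m generalizing n with
  | zero => cases n <;> simp_all [encodeUnary, List.replicate_succ]
  | succ m ih =>
    cases n with
    | zero => simp_all [encodeUnary, List.replicate_succ]
    | succ n =>
      have := @ih n (by simpa [encodeUnary, List.replicate_succ] using h)
      exact ⟨by rw [this.1], this.2⟩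

theorem encodeList_append_inj {β : Type} {e : β → List Bool}
    (he : ∀ {a b : β} {s t : List Bool}, e a ++ s = e b ++ t → a = b ∧ s = t)
    {l l' : List β} {s t : List Bool}
    (h : encodeList e l ++ s = encodeList e l' ++ t) : l = l' ∧ s = t := by
  induction l generalizing l' with
  | nil => cases l' <;> simp_all [encodeList]
  | cons a l ih =>
    cases l' with
    | nil => simp_all [encodeList]
    | cons b l' =>
      have h1 : e a ++ (encodeList e l ++ s) = e b ++ (encodeList e l' ++ t) := by
        simpa [encodeList] using h
      obtain ⟨rfl, h2⟩ := he h1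
      obtain ⟨rfl, h3⟩ := ih h2
      exact ⟨rfl, h3⟩

/-- An automaton can be recovered from its code. -/
theorem encode_injective : Function.Injective encode := by
  rintro ⟨k, hk, n, i, f, r⟩ ⟨k', hk', n', i', f', r'⟩ h
  have hfin : ∀ {N : ℕ} {a b : Fin N} {s t : List Bool},
      encodeFin a ++ s = encodeFin b ++ t → a = b ∧ s = t := fun h =>
    ⟨Fin.ext (encodeUnary_append_inj h).1, (encodeUnary_append_inj h).2⟩
  have htr : ∀ {a b : Fin n × Fin k × Fin n} {s t : List Bool},
      encodeTransition a ++ s = encodeTransition b ++ t → a = b ∧ s = t := by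
    rintro ⟨a1, a2, a3⟩ ⟨b1, b2, b3⟩ s t h
    simp only [encodeTransition, List.append_assoc] at h
    have h1 := hfin h
    have h2 := hfin h1.2
    have h3 := hfin h2.2
    exact ⟨by rw [h1.1, h2.1, h3.1], h3.2⟩
  simp only [encode, List.append_assoc] at h
  obtain ⟨rfl, h⟩ := encodeUnary_append_inj h
  obtain ⟨rfl, h⟩ := encodeUnary_append_inj h
  have h1 := encodeList_append_inj hfin h
  have h2 := encodeList_append_inj hfin h1.2
  have h3 := h2.2
  rw [← List.append_nil (encodeList _ r), ← List.append_nil (encodeList _ r')] at h3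
  rw [h1.1, h2.1, (encodeList_append_inj htr h3).1]

/-- The metric `F` causes an `f`-blow-up for `A`. Here `A.states` is the size of `A`. -/
def CausesBlowUp (F : FSA → ℕ) (f : ℕ → ℕ) (A : FSA) : Prop :=
  f A.states < F A

/-- The number `m` is an `f`-approximation of the metric `F` on `A`. -/
def IsApproximation (F : FSA → ℕ) (f : ℕ → ℕ) (A : FSA) (m : ℕ) : Prop :=
  F A ≤ m ∧ m ≤ f (F A + A.states)

end FSA

/-!
A language in PSPACE is reduced to a gap in the state complexity. Let `M` be a machine for it and `x`
an input of length `n`, and let `S = (n + c) ^ d` be at least the space that `M` needs. The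
computation of `M` on `x` is written as one infinite word, its trace, in which the configurations
follow each other in blocks of `S + 1` letters. Each letter behind the first block is a function of
the three letters around its position one block earlier (`SpaceTM.isTrace_trace`), and `M` accepts
if and only if the trace contains a letter with the accepting state (`SpaceTM.mem_iff_exists_acc`).

Let `Σ` be the alphabet of traces and `$` a new letter. The automaton `TraceSystem.nfa` accepts the
words `w $ v` for which `w` deviates from the trace or lacks accepting letters, and also those words
`w $ v` with `v` over `Σ` in which the letter with exactly `S` successors is a fixed one. Deviations
are detected by guessing a window of three letters and comparing the letter that they predict after
counting `S` letters, so polynomially many states suffice. If `M` rejects, then the automaton accepts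
all words that contain `$`, and the state complexity is at most `2`
(`TraceSystem.stateComplexity_le_two`). If `M` accepts, then behind a prefix of the trace with an
accepting letter a deterministic automaton has to remember which of the last `S + 1` letters are the
fixed one, and the state complexity is at least `2 ^ (S + 1)`
(`TraceSystem.two_pow_le_stateComplexity`). The number of states of the nondeterministic automaton is
a polynomial of `n + c`, so for large `c` the number `2 ^ (n + c)` exceeds `f` at all relevant
arguments. Hence a blow-up occurs if and only if `M` accepts, and an approximation of the state
complexity reveals by its number of binary digits whether `M` accepts.

Polynomial-time computability is shown with a small structured programming language on stacks,
`StackProg`, which is compiled to machines of the type `Turing.FinTM2`; the relation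
`StackProg.Runs` describes the effect and the running time of a program. The states of the automaton
are pairs of a track and an index `j ≤ S`, and the transitions at the index `j` depend only on `j`
and the letter `x[j]?`. The code of the automaton is therefore printed by one loop over `j` whose
body fills the counter `j` into fixed templates (`StackProg.runs_printProg`,
`TraceSystem.encode_fsa`).
-/

/-! ### Structured programs on stacks and their compilation -/

open Turing

/-- Structured programs that operate on finitely many stacks, where stack `k` has the alphabet
`Γ k`. The only variable is a register with values in `Option τ`; it holds the symbol read last. -/
inductive StackProg {K : Type} (Γ : K → Type) (τ : Type) : Type
  /-- Push a symbol, which may depend on the register, on stack `k`. -/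
  | push (k : K) (f : Option τ → Γ k) : StackProg Γ τ
  /-- Pop stack `k` into the register (`none` if it is empty) and continue with `p`. -/
  | pop (k : K) (p : StackProg Γ τ) : StackProg Γ τ
  | ite (c : Option τ → Bool) (p q : StackProg Γ τ) : StackProg Γ τ
  | skip : StackProg Γ τ
  | seq (p q : StackProg Γ τ) : StackProg Γ τ
  /-- While stack `k` is not empty, pop it into the register and run `p`. -/
  | loop (k : K) (p : StackProg Γ τ) : StackProg Γ τ

namespace StackProg

variable {K : Type} {Γ : K → Type} {τ : Type}

/-- The labels that the compiled program needs: one for the head of each loop. -/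
def Labels : StackProg Γ τ → Type
  | push _ _ => Empty
  | pop _ p => Labels p
  | ite _ p q => Labels p ⊕ Labels q
  | skip => Empty
  | seq p q => Labels p ⊕ Labels q
  | loop _ p => Option (Labels p)

/-- A program has finitely many labels. -/
@[reducible]
def labelsFintype : ∀ p : StackProg Γ τ, Fintype p.Labels
  | push _ _ => inferInstanceAs (Fintype Empty)
  | pop _ p => labelsFintype p
  | ite _ p q => @instFintypeSum _ _ (labelsFintype p) (labelsFintype q)
  | skip => inferInstanceAs (Fintype Empty)
  | seq p q => @instFintypeSum _ _ (labelsFintype p) (labelsFintype q)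
  | loop _ p => @instFintypeOption _ (labelsFintype p)

variable {Λ : Type}

/-- The statement that starts the program `p` and finally continues with the statement `q`. The
labels of `p` are placed among those of the whole machine by `emb`, and `rd` says how the symbols
of each stack are stored in the register. -/
def entry (rd : ∀ k, Γ k → τ) :
    ∀ p : StackProg Γ τ, (p.Labels → Λ) → TM2.Stmt Γ Λ (Option τ) → TM2.Stmt Γ Λ (Option τ)
  | push k f, _, q => .push k f q
  | pop k p, emb, q => .pop k (fun _ a => a.map (rd k)) (entry rd p emb q)
  | ite c p p', emb, q =>
      .branch c (entry rd p (fun l => emb (Sum.inl l)) q)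
        (entry rd p' (fun l => emb (Sum.inr l)) q)
  | skip, _, q => q
  | seq p p', emb, q =>
      entry rd p (fun l => emb (Sum.inl l)) (entry rd p' (fun l => emb (Sum.inr l)) q)
  | loop _ _, emb, _ => .goto fun _ => emb none

/-- The statements at the labels of the program `p`, if `p` is followed by the statement `q`. -/
def code (rd : ∀ k, Γ k → τ) :
    ∀ p : StackProg Γ τ, (p.Labels → Λ) → TM2.Stmt Γ Λ (Option τ) → p.Labels →
      TM2.Stmt Γ Λ (Option τ)
  | push _ _, _, _ => Empty.elim
  | skip, _, _ => Empty.elim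
  | pop _ p, emb, q => code rd p emb q
  | ite _ p p', emb, q => fun l => match l with
      | Sum.inl l => code rd p (fun l => emb (Sum.inl l)) q l
      | Sum.inr l => code rd p' (fun l => emb (Sum.inr l)) q l
  | seq p p', emb, q => fun l => match l with
      | Sum.inl l =>
          code rd p (fun l => emb (Sum.inl l)) (entry rd p' (fun l => emb (Sum.inr l)) q) l
      | Sum.inr l => code rd p' (fun l => emb (Sum.inr l)) q l
  | loop k p, emb, q => fun l => match l with
      | none => .pop k (fun _ a => a.map (rd k)) (.branch Option.isSome
          (entry rd p (fun l => emb (some l)) (.goto fun _ => emb none)) q)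
      | some l => code rd p (fun l => emb (some l)) (.goto fun _ => emb none) l

variable [DecidableEq K]

/-- The machine `m` gets from `a` to `b` in at most `t` steps. -/
def ReachesIn (m : Λ → TM2.Stmt Γ Λ (Option τ)) (a b : TM2.Cfg Γ Λ (Option τ)) (t : ℕ) : Prop :=
  ∃ n ≤ t, (flip bind (TM2.step m))^[n] (some a) = some b

theorem ReachesIn.refl (m : Λ → TM2.Stmt Γ Λ (Option τ)) (a : TM2.Cfg Γ Λ (Option τ)) (t : ℕ) :
    ReachesIn m a a t :=
  ⟨0, Nat.zero_le _, rfl⟩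

theorem ReachesIn.trans {m : Λ → TM2.Stmt Γ Λ (Option τ)} {a b c : TM2.Cfg Γ Λ (Option τ)}
    {s t : ℕ} (h : ReachesIn m a b s) (h' : ReachesIn m b c t) : ReachesIn m a c (s + t) := by
  obtain ⟨i, hi, h⟩ := h
  obtain ⟨j, hj, h'⟩ := h'
  exact ⟨j + i, by omega, by rw [Function.iterate_add_apply, h, h']⟩

theorem ReachesIn.of_goto (m : Λ → TM2.Stmt Γ Λ (Option τ)) (l : Λ) (v : Option τ)
    (S : ∀ k, List (Γ k)) :
    ReachesIn m (TM2.stepAux (.goto fun _ => l) v S) (TM2.stepAux (m l) v S) 1 :=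
  ⟨1, le_rfl, rfl⟩

/-- Started with the value `v` of the register and the stacks `S`, the program `p` ends with the
stacks `S'` after at most `t` steps of the compiled machine, whatever machine `p` is part of. The
final value of the register is left open. -/
def Runs (rd : ∀ k, Γ k → τ) (p : StackProg Γ τ) (v : Option τ) (S S' : ∀ k, List (Γ k))
    (t : ℕ) : Prop :=
  ∀ (Λ : Type) (m : Λ → TM2.Stmt Γ Λ (Option τ)) (emb : p.Labels → Λ)
    (q : TM2.Stmt Γ Λ (Option τ)), (∀ l, m (emb l) = code rd p emb q l) →
    ∃ v', ReachesIn m (TM2.stepAux (entry rd p emb q) v S) (TM2.stepAux q v' S') t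

variable {rd : ∀ k, Γ k → τ} {p p' : StackProg Γ τ} {v : Option τ} {S S' S'' : ∀ k, List (Γ k)}
  {k : K} {t t' : ℕ}

theorem Runs.mono (h : Runs rd p v S S' t) (htt' : t ≤ t') : Runs rd p v S S' t' := by
  intro Λ m emb q hm
  obtain ⟨v', n, hn, h⟩ := h Λ m emb q hm
  exact ⟨v', n, hn.trans htt', h⟩

theorem Runs.skip : Runs rd skip v S S 0 :=
  fun _ m _ q _ => ⟨v, .refl m (TM2.stepAux q v S) 0⟩

theorem Runs.push (f : Option τ → Γ k) :
    Runs rd (push k f) v S (Function.update S k (f v :: S k)) 0 :=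
  fun _ m _ q _ => ⟨v, .refl m (TM2.stepAux q v _) 0⟩

theorem Runs.pop
    (h : Runs rd p ((S k).head?.map (rd k)) (Function.update S k (S k).tail) S' t) :
    Runs rd (pop k p) v S S' t :=
  fun Λ m emb q hm => h Λ m emb q hm

theorem Runs.ite {c : Option τ → Bool} (h : Runs rd (bif c v then p else p') v S S' t) :
    Runs rd (ite c p p') v S S' t := by
  intro Λ m emb q hm
  cases hc : c v
  · rw [hc] at h
    simpa [entry, hc] using h Λ m (fun l => emb (Sum.inr l)) q fun l => hm (Sum.inr l)
  · rw [hc] at h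
    simpa [entry, hc] using h Λ m (fun l => emb (Sum.inl l)) q fun l => hm (Sum.inl l)

theorem Runs.seq (h : Runs rd p v S S' t) (h' : ∀ v, Runs rd p' v S' S'' t') :
    Runs rd (seq p p') v S S'' (t + t') := by
  intro Λ m emb q hm
  obtain ⟨w, hw⟩ := h Λ m (fun l => emb (Sum.inl l)) _ fun l => hm (Sum.inl l)
  obtain ⟨w', hw'⟩ := h' w Λ m (fun l => emb (Sum.inr l)) q fun l => hm (Sum.inr l)
  exact ⟨w', hw.trans hw'⟩

theorem Runs.loop_nil (hS : S k = []) : Runs rd (loop k p) v S S 1 := by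
  intro Λ m emb q hm
  refine ⟨none, ?_⟩
  have h := ReachesIn.of_goto m (emb none) v S
  rw [hm none] at h
  have e : Function.update S k [] = S := by rw [← hS, Function.update_eq_self]
  simpa [entry, code, hS, e] using h

theorem Runs.loop_cons {a : Γ k} {l : List (Γ k)} (hS : S k = a :: l)
    (h : Runs rd p (some (rd k a)) (Function.update S k l) S' t)
    (h' : ∀ v, Runs rd (loop k p) v S' S'' t') :
    Runs rd (loop k p) v S S'' (1 + (t + t')) := by
  intro Λ m emb q hm
  obtain ⟨w, hw⟩ := h Λ m (fun l => emb (some l)) _ fun l => hm (some l)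
  obtain ⟨w', hw'⟩ := h' w Λ m emb q hm
  refine ⟨w', ReachesIn.trans ?_ (hw.trans hw')⟩
  have h := ReachesIn.of_goto m (emb none) v S
  rw [hm none] at h
  simpa [entry, code, hS] using h

/-- The rule for loops: `l` is the content of the stack `k` that controls the loop, and `T i` are
the contents of the stacks after `i` rounds. -/
theorem Runs.loop_rounds {l : List (Γ k)} (T : ℕ → ∀ k, List (Γ k))
    (hT : ∀ i ≤ l.length, T i k = l.drop i)
    (h : ∀ (i : ℕ) (hi : i < l.length), Runs rd p (some (rd k l[i]))
      (Function.update (T i) k (l.drop (i + 1))) (T (i + 1)) t) :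
    Runs rd (loop k p) v (T 0) (T l.length) (l.length * (t + 1) + 1) := by
  suffices H : ∀ n i, i + n = l.length → ∀ v,
      Runs rd (loop k p) v (T i) (T l.length) (n * (t + 1) + 1) from H l.length 0 (Nat.zero_add _) v
  intro n
  induction n with
  | zero =>
    intro i hi v
    obtain rfl : i = l.length := by omega
    refine (Runs.loop_nil ?_).mono (by omega)
    rw [hT _ le_rfl, List.drop_length]
  | succ n ih =>
    intro i hi v
    have hil : i < l.length := by omega
    refine (Runs.loop_cons (a := l[i]) (l := l.drop (i + 1)) ?_ (h i hil)
      (ih (i + 1) (by omega))).mono (le_of_eq (by ring))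
    rw [hT i hil.le, List.drop_eq_getElem_cons hil]

/-- The machine that runs a program and then halts. -/
def toFinTM2 [Fintype K] [Fintype τ] (rd : ∀ k, Γ k → τ) (p : StackProg Γ τ) (k₀ k₁ : K)
    [Fintype (Γ k₀)] : FinTM2 where
  k₀ := k₀
  k₁ := k₁
  Γ := Γ
  Λ := Option p.Labels
  main := none
  ΛFin := @instFintypeOption _ p.labelsFintype
  σ := Option τ
  initialState := none
  m
    | none => entry rd p some (.load (fun _ => none) .halt)
    | some l => code rd p some (.load (fun _ => none) .halt) l

theorem initList_eq (tm : FinTM2) (s : List (tm.Γ tm.k₀)) :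
    initList tm s = ⟨some tm.main, tm.initialState, Function.update (fun _ => []) tm.k₀ s⟩ := by
  unfold initList
  congr 1
  funext k
  by_cases hk : k = tm.k₀
  · subst hk
    simp
  · rw [Function.update_of_ne hk]
    exact dif_neg hk

theorem haltList_eq (tm : FinTM2) (s : List (tm.Γ tm.k₁)) :
    haltList tm s = ⟨none, tm.initialState, Function.update (fun _ => []) tm.k₁ s⟩ := by
  unfold haltList
  congr 1
  funext k
  by_cases hk : k = tm.k₁
  · subst hk
    simp
  · rw [Function.update_of_ne hk]
    exact dif_neg hk

/-- A program computes a function in polynomial time if it transforms the input on the stack `k₀`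
into the output on the stack `k₁`, where all other stacks are empty before and after. -/
theorem computableInPolyTime [Fintype K] [Fintype τ] {α β A B : Type} {ea : α → List A}
    {eb : β → List B} {f : α → β} (rd : ∀ k, Γ k → τ) (p : StackProg Γ τ) (k₀ k₁ : K)
    [hΓ : Fintype (Γ k₀)] (e₀ : Γ k₀ ≃ A) (e₁ : Γ k₁ ≃ B) (P : Polynomial ℕ)
    (h : ∀ a, Runs rd p none (Function.update (fun _ => []) k₀ ((ea a).map e₀.symm))
      (Function.update (fun _ => []) k₁ ((eb (f a)).map e₁.symm)) (P.eval (ea a).length)) :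
    Nonempty (TM2ComputableInPolyTime ea eb f) := by
  have H : ∀ a, ∃ n ≤ (P + 1).eval (ea a).length,
      (flip bind (p.toFinTM2 rd k₀ k₁).step)^[n]
        (some (initList (p.toFinTM2 rd k₀ k₁) ((ea a).map e₀.symm))) =
        some (haltList (p.toFinTM2 rd k₀ k₁) ((eb (f a)).map e₁.symm)) := by
    intro a
    obtain ⟨v', n, hn, hr⟩ := h a (Option p.Labels) (p.toFinTM2 rd k₀ k₁).m some
      (.load (fun _ => none) .halt) fun _ => rfl
    refine ⟨n + 1, by simpa using hn, ?_⟩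
    rw [Function.iterate_succ_apply, initList_eq, haltList_eq]
    exact hr
  choose n hn hr using H
  exact ⟨{
    tm := p.toFinTM2 rd k₀ k₁
    inputAlphabet := e₀
    outputAlphabet := e₁
    time := P + 1
    outputsFun := fun a => { steps := n a, evals_in_steps := hr a, steps_le_m := hn a } }⟩

end StackProg

/-! ### Nondeterministic automata that detect errors in traces -/

/-- A family of infinite words over `Λ`, one for each input and each block length, in which each
letter after the first block is determined by three letters of the block before. -/
structure TraceSystem (Λ : Type) where
  /-- The letter at a position, given the three letters around this position in the last block. -/
  next : Λ → Λ → Λ → Λ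
  /-- The letters of the first block after its first letter: they carry the input and blanks. -/
  cell : Option Bool → Λ
  /-- The first letter of the first block. -/
  first : Λ
  /-- The letters whose occurrence means acceptance. -/
  acc : Λ → Prop
  cell_ne_first : ∀ o, cell o ≠ first

namespace TraceSystem

/-- The components of the states of the automaton. A state consists of a track and an index. The
tracks `skip`, `init` and `count` use all indices, the others only the index `0`. -/
inductive Track (Λ : Type)
  /-- No `$` has been read. -/
  | free
  /-- The last letter was `a`. -/
  | win1 (a : Λ)
  /-- The last two letters were `a` and `b`. -/
  | win2 (a b : Λ)
  /-- Neither `$` nor an accepting letter has been read. -/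
  | noacc
  /-- Nothing has been read. -/
  | initWall
  /-- A deviation from the trace has been found, and no `$` has been read. -/
  | err
  /-- The word is accepted, whatever follows. -/
  | top
  /-- Exactly one `$` has been read. -/
  | kfree
  /-- A window predicts the letter `e`, which is compared when the index has reached its maximum. -/
  | skip (e : Λ)
  /-- The first letter and as many further letters as the index says agree with the trace. -/
  | init
  /-- The index is the number of letters since a guessed occurrence of the letter `first`. -/
  | count
  deriving Fintype

/-- The index of a state in a transition of round `j`. -/
inductive Place
  | zero
  | one
  | cur
  | succ
  deriving DecidableEq

instance : Fintype Place :=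
  ⟨{.zero, .one, .cur, .succ}, by rintro (_ | _ | _ | _) <;> simp⟩

/-- The index that a place stands for in round `j`. -/
def Place.pos (j : ℕ) : Place → ℕ
  | zero => 0
  | one => 1
  | cur => j
  | succ => j + 1

/-- The transitions come in three kinds: those between the indices `0` and `1`, those from an
index `j` to `j + 1` or `0`, which depend on letter `j` of the input, and those from the maximal
index. -/
inductive Phase
  | hub
  | round (o : Option Bool)
  | last

variable {Λ : Type}

/-- The transitions of the automaton. The letters are those of `Λ` and the separator `$`, which is
`none`. -/
inductive Rule (T : TraceSystem Λ) :
    Phase → Place × Track Λ → Option Λ → Place × Track Λ → Prop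
  | free (a : Λ) : Rule T .hub (.zero, .free) (some a) (.zero, .free)
  | free_win1 (a : Λ) : Rule T .hub (.zero, .free) (some a) (.zero, .win1 a)
  | win1 (a b : Λ) : Rule T .hub (.zero, .win1 a) (some b) (.zero, .win2 a b)
  | win2 (a b c : Λ) : Rule T .hub (.zero, .win2 a b) (some c) (.one, .skip (T.next a b c))
  | noacc (a : Λ) : ¬ T.acc a → Rule T .hub (.zero, .noacc) (some a) (.zero, .noacc)
  | initWall : Rule T .hub (.zero, .initWall) (some T.first) (.zero, .init)
  | initWall_err (a : Λ) : a ≠ T.first → Rule T .hub (.zero, .initWall) (some a) (.zero, .err)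
  | err (a : Λ) : Rule T .hub (.zero, .err) (some a) (.zero, .err)
  | err_top : Rule T .hub (.zero, .err) none (.zero, .top)
  | noacc_top : Rule T .hub (.zero, .noacc) none (.zero, .top)
  | top (a : Option Λ) : Rule T .hub (.zero, .top) a (.zero, .top)
  | free_kfree : Rule T .hub (.zero, .free) none (.zero, .kfree)
  | kfree (a : Λ) : Rule T .hub (.zero, .kfree) (some a) (.zero, .kfree)
  | kfree_count : Rule T .hub (.zero, .kfree) (some T.first) (.zero, .count)
  | skip (o : Option Bool) (e a : Λ) :
      Rule T (.round o) (.cur, .skip e) (some a) (.succ, .skip e)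
  | init (o : Option Bool) : Rule T (.round o) (.cur, .init) (some (T.cell o)) (.succ, .init)
  | init_err (o : Option Bool) (a : Λ) : a ≠ T.cell o →
      Rule T (.round o) (.cur, .init) (some a) (.zero, .err)
  | count (o : Option Bool) (a : Λ) : Rule T (.round o) (.cur, .count) (some a) (.succ, .count)
  | skip_err (e a : Λ) : a ≠ e → Rule T .last (.cur, .skip e) (some a) (.zero, .err)

/-- Round `j` uses the transitions of the given kind. -/
def Phase.At (S : ℕ) (x : List Bool) (j : ℕ) : Phase → Prop
  | hub => j = 0
  | round o => j < S ∧ o = x[j]?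
  | last => j = S

/-- The state that a pair of a place and a track stands for in round `j`. -/
def loc (j : ℕ) (r : Place × Track Λ) : ℕ × Track Λ :=
  (r.1.pos j, r.2)

/-- The automaton for the input `x` and the block length `S + 1`. It accepts the words `w $ v` for
which `w` contains no `$` and either deviates from the trace or lacks accepting letters, and the
words `w $ v` without further `$` in which the letter `first` has exactly `S` successors in `v`. -/
def nfa (T : TraceSystem Λ) (S : ℕ) (x : List Bool) : NFA (Option Λ) (ℕ × Track Λ) where
  step q a := {q' | ∃ ph j r r', Phase.At S x j ph ∧ T.Rule ph r a r' ∧ q = loc j r ∧ q' = loc j r'}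
  start := {q | q ∈ [(0, Track.free), (0, .win1 T.first), (0, .noacc), (0, .initWall)]}
  accept := {q | q ∈ [(0, Track.top), (S, .count)]}

/-- The sequence `V` is the trace on input `x` with block length `S + 1`, preceded by an additional
letter `V 0`, which gives the first letter of the trace a left neighbour. -/
structure IsTrace (T : TraceSystem Λ) (S : ℕ) (x : List Bool) (V : ℕ → Λ) : Prop where
  zero : V 0 = T.first
  one : V 1 = T.first
  init : ∀ i < S, V (i + 2) = T.cell x[i]?
  next : ∀ i, V (i + S + 2) = T.next (V i) (V (i + 1)) (V (i + 2))

/-- The first `m` letters of a trace. -/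
def tracePrefix (V : ℕ → Λ) (m : ℕ) : List Λ :=
  (List.range m).map fun i => V (i + 1)

theorem tracePrefix_succ (V : ℕ → Λ) (m : ℕ) :
    tracePrefix V (m + 1) = tracePrefix V m ++ [V (m + 1)] := by
  simp [tracePrefix, List.range_succ]

/-- A finite word is a prefix of the trace, or there is a first deviation. -/
theorem eq_tracePrefix_or (V : ℕ → Λ) (w : List Λ) :
    w = tracePrefix V w.length ∨
      ∃ m a v, w = tracePrefix V m ++ a :: v ∧ a ≠ V (m + 1) := by
  induction w using List.reverseRecOn with
  | nil => exact Or.inl rfl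
  | append_singleton w b ih =>
    rcases ih with h | ⟨m, a, v, h, ha⟩
    · by_cases hb : b = V (w.length + 1)
      · left
        rw [List.length_append, List.length_singleton, tracePrefix_succ, ← h, hb]
      · exact Or.inr ⟨w.length, b, [], by rw [← h], hb⟩
    · exact Or.inr ⟨m, a, v ++ [b], by rw [h]; simp, ha⟩

variable {T : TraceSystem Λ} {S : ℕ} {x : List Bool} {V : ℕ → Λ}

theorem mem_eval_append {q q' : ℕ × Track Λ} {w : List (Option Λ)} {a : Option Λ}
    (h : q ∈ (T.nfa S x).eval w) (h' : q' ∈ (T.nfa S x).step q a) :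
    q' ∈ (T.nfa S x).eval (w ++ [a]) := by
  rw [NFA.eval_append_singleton]
  exact NFA.mem_stepSet.2 ⟨q, h, h'⟩

theorem exists_of_mem_eval_append {q' : ℕ × Track Λ} {w : List (Option Λ)} {a : Option Λ}
    (h : q' ∈ (T.nfa S x).eval (w ++ [a])) :
    ∃ q ∈ (T.nfa S x).eval w, q' ∈ (T.nfa S x).step q a := by
  rw [NFA.eval_append_singleton] at h
  exact NFA.mem_stepSet.1 h

theorem hub_mem_step {r r' : Place × Track Λ} {a : Option Λ} (h : T.Rule .hub r a r') :
    loc 0 r' ∈ (T.nfa S x).step (loc 0 r) a :=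
  ⟨.hub, 0, r, r', rfl, h, rfl, rfl⟩

theorem round_mem_step {j : ℕ} (hj : j < S) {r r' : Place × Track Λ} {a : Option Λ}
    (h : T.Rule (.round x[j]?) r a r') : loc j r' ∈ (T.nfa S x).step (loc j r) a :=
  ⟨.round x[j]?, j, r, r', ⟨hj, rfl⟩, h, rfl, rfl⟩

theorem last_mem_step {r r' : Place × Track Λ} {a : Option Λ} (h : T.Rule .last r a r') :
    loc S r' ∈ (T.nfa S x).step (loc S r) a :=
  ⟨.last, S, r, r', rfl, h, rfl, rfl⟩

/-! ### Words that follow the trace -/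

/-- What a state that is reached by the first `m` letters of a trace says about `m`. -/
def Inv (T : TraceSystem Λ) (S : ℕ) (V : ℕ → Λ) (m : ℕ) (q : ℕ × Track Λ) : Prop :=
  match q.2 with
  | .free => True
  | .win1 a => a = V m
  | .win2 a b => ∃ i, m = i + 1 ∧ a = V i ∧ b = V (i + 1)
  | .noacc => ∀ i < m, ¬ T.acc (V (i + 1))
  | .initWall => m = 0
  | .skip e => 1 ≤ q.1 ∧ q.1 ≤ S ∧ e = V (m + S + 1 - q.1)
  | .init => m = q.1 + 1
  | .err => False
  | .top => False
  | .kfree => False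
  | .count => False

theorem inv_of_mem_eval (hS : 1 ≤ S) (hV : T.IsTrace S x V) (m : ℕ) (q : ℕ × Track Λ)
    (h : q ∈ (T.nfa S x).eval ((tracePrefix V m).map some)) : T.Inv S V m q := by
  induction m generalizing q with
  | zero =>
    have h : q ∈ [(0, Track.free), (0, .win1 T.first), (0, .noacc), (0, .initWall)] := h
    simp only [List.mem_cons, List.not_mem_nil, or_false] at h
    rcases h with rfl | rfl | rfl | rfl <;> simp [Inv, hV.zero]
  | succ m ih =>
    rw [tracePrefix_succ, List.map_append] at h
    obtain ⟨q₀, hq₀, ph, j, r, r', hat, hr, rfl, rfl⟩ := exists_of_mem_eval_append h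
    have ih := ih _ hq₀
    generalize ha : (some (V (m + 1)) : Option Λ) = a at hr
    cases hr <;> (try simp only [Option.some.injEq, reduceCtorEq] at ha) <;>
      simp only [Inv, loc, Place.pos] at ih ⊢
    case free_win1 => exact ha.symm
    case win1 => exact ⟨m, rfl, ih, ha.symm⟩
    case win2 =>
      obtain ⟨i, rfl, rfl, rfl⟩ := ih
      refine ⟨le_rfl, hS, ?_⟩
      rw [← ha, ← hV.next]
      congr 1
      omega
    case noacc hb =>
      intro i hi
      rcases Nat.lt_succ_iff_lt_or_eq.1 hi with hi | rfl
      · exact ih i hi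
      · rwa [ha]
    case initWall => omega
    case initWall_err hb =>
      subst ih
      exact hb (ha.symm.trans hV.one)
    case skip =>
      obtain ⟨h1, -, h2⟩ := ih
      have hj : j < S := hat.1
      refine ⟨by omega, by omega, ?_⟩
      rw [h2]
      congr 1
      omega
    case init => omega
    case init_err hb =>
      subst ih
      obtain ⟨hj, rfl⟩ := hat
      exact hb (ha.symm.trans (hV.init j hj))
    case skip_err hb =>
      obtain ⟨-, -, h2⟩ := ih
      obtain rfl : j = S := hat
      apply hb
      rw [← ha, h2]
      congr 1
      omega

/-- The states that are needed to detect an error are reached by the first `m` letters of a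
trace. -/
theorem mem_eval_tracePrefix (hV : T.IsTrace S x V) (m : ℕ) :
    (0, .free) ∈ (T.nfa S x).eval ((tracePrefix V m).map some) ∧
    (0, .win1 (V m)) ∈ (T.nfa S x).eval ((tracePrefix V m).map some) ∧
    (∀ i, m = i + 1 → (0, .win2 (V i) (V m)) ∈
      (T.nfa S x).eval ((tracePrefix V m).map some)) ∧
    (∀ j, 1 ≤ j → j ≤ S → j + 1 ≤ m → (j, .skip (V (m + S + 1 - j))) ∈
      (T.nfa S x).eval ((tracePrefix V m).map some)) ∧
    (m = 0 → (0, .initWall) ∈ (T.nfa S x).eval ((tracePrefix V m).map some)) ∧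
    (∀ j ≤ S, m = j + 1 → (j, .init) ∈ (T.nfa S x).eval ((tracePrefix V m).map some)) := by
  induction m with
  | zero =>
    have hs : ∀ q ∈ [(0, Track.free), (0, .win1 T.first), (0, .noacc), (0, .initWall)],
        q ∈ (T.nfa S x).eval ((tracePrefix V 0).map some) := fun q hq => hq
    exact ⟨hs _ (by simp), hs _ (by simp [hV.zero]), by omega, by omega,
      fun _ => hs _ (by simp), by omega⟩
  | succ m ih =>
    obtain ⟨h1, h2, h3, h4, h5, h6⟩ := ih
    rw [tracePrefix_succ, List.map_append]
    refine ⟨mem_eval_append h1 (hub_mem_step (.free _)),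
      mem_eval_append h1 (hub_mem_step (.free_win1 _)), ?_, ?_, by omega, ?_⟩
    · rintro i hi
      obtain rfl : m = i := by omega
      exact mem_eval_append h2 (hub_mem_step (.win1 _ _))
    · -- The window behind this prediction was completed `j - 1` letters ago.
      intro j hj hjS hjm
      obtain rfl | hj := hj.eq_or_lt
      · obtain ⟨i, rfl⟩ : ∃ i, m = i + 1 := ⟨m - 1, by omega⟩
        have h := mem_eval_append (h3 i rfl)
          (hub_mem_step (.win2 (V i) (V (i + 1)) (V (i + 1 + 1))))
        rw [← hV.next] at h
        exact (show i + 1 + 1 + S + 1 - 1 = i + S + 2 by omega) ▸ h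
      · obtain ⟨j, rfl⟩ : ∃ i, j = i + 1 := ⟨j - 1, by omega⟩
        have h := mem_eval_append (h4 j (by omega) (by omega) (by omega))
          (round_mem_step (x := x) (show j < S by omega)
            (.skip (T := T) _ (V (m + S + 1 - j)) (V (m + 1))))
        exact (show m + 1 + S + 1 - (j + 1) = m + S + 1 - j by omega) ▸ h
    · intro j hjS hj
      obtain rfl : m = j := by omega
      rcases m with _ | m
      · have h := mem_eval_append (h5 rfl) (hub_mem_step .initWall)
        rw [← hV.one] at h
        exact h
      · have h := mem_eval_append (h6 m (by omega) rfl)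
          (round_mem_step (show m < S by omega) (.init (T := T) _))
        rw [← hV.init m (by omega)] at h
        exact h

/-- A deviation from the trace is detected: in the first letter by the track `initWall`, in the rest
of the first block by `init`, and later by the window around the same position one block earlier. -/
theorem err_mem_eval (hS : 1 ≤ S) (hV : T.IsTrace S x V) {m : ℕ} {a : Λ} (ha : a ≠ V (m + 1))
    (v : List Λ) :
    (0, .err) ∈ (T.nfa S x).eval ((tracePrefix V m ++ a :: v).map some) := by
  induction v using List.reverseRecOn with
  | nil =>
    obtain ⟨-, -, -, h4, h5, h6⟩ := mem_eval_tracePrefix hV m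
    rw [List.map_append]
    rcases m with _ | m
    · exact mem_eval_append (h5 rfl) (hub_mem_step (.initWall_err a (by rwa [← hV.one])))
    · by_cases hm : m < S
      · exact mem_eval_append (h6 m hm.le rfl)
          (round_mem_step hm (.init_err _ a (by rwa [← hV.init m hm])))
      · have h := h4 S hS le_rfl (by omega)
        rw [show m + 1 + S + 1 - S = m + 1 + 1 by omega] at h
        exact mem_eval_append h (last_mem_step (.skip_err _ a ha))
  | append_singleton v b ih =>
    have e : (tracePrefix V m ++ a :: (v ++ [b])).map some =
        (tracePrefix V m ++ a :: v).map some ++ [some b] := by simp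
    rw [e]
    exact mem_eval_append ih (hub_mem_step (.err b))

theorem noacc_mem_eval (w : List Λ) (hw : ∀ a ∈ w, ¬ T.acc a) :
    (0, .noacc) ∈ (T.nfa S x).eval (w.map some) := by
  induction w using List.reverseRecOn with
  | nil => exact show _ ∈ [_, _, _, _] by simp
  | append_singleton w b ih =>
    rw [List.map_append]
    exact mem_eval_append (ih fun a ha => hw a (by simp [ha]))
      (hub_mem_step (.noacc b (hw b (by simp))))

theorem top_mem_eval {w : List (Option Λ)} (hw : (0, .top) ∈ (T.nfa S x).eval w)
    (v : List (Option Λ)) : (0, .top) ∈ (T.nfa S x).eval (w ++ v) := by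
  induction v using List.reverseRecOn with
  | nil => simpa using hw
  | append_singleton v b ih =>
    rw [← List.append_assoc]
    exact mem_eval_append ih (hub_mem_step (.top b))

theorem not_accept_of_none_notMem {w : List (Option Λ)} (hw : none ∉ w) {q : ℕ × Track Λ}
    (h : q ∈ (T.nfa S x).eval w) : q.2 ≠ .top ∧ q.2 ≠ .kfree ∧ q.2 ≠ .count := by
  induction w using List.reverseRecOn generalizing q with
  | nil =>
    have h : q ∈ [(0, Track.free), (0, .win1 T.first), (0, .noacc), (0, .initWall)] := h
    simp only [List.mem_cons, List.not_mem_nil, or_false] at h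
    rcases h with rfl | rfl | rfl | rfl <;> simp
  | append_singleton w b ih =>
    obtain ⟨q₀, hq₀, ph, j, r, r', hat, hr, rfl, rfl⟩ := exists_of_mem_eval_append h
    have ih := ih (fun h => hw (by simp [h])) hq₀
    have hb : none ≠ b := fun h => hw (by simp [h])
    cases hr <;> simp_all [loc]

/-- If no letter of the trace is accepting, then the automaton accepts all words that contain the
separator. -/
theorem mem_accepts_of_not_acc (hS : 1 ≤ S) (hV : T.IsTrace S x V)
    (hacc : ∀ i, ¬ T.acc (V (i + 1))) (w : List (Option Λ)) :
    w ∈ (T.nfa S x).accepts ↔ none ∈ w := by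
  constructor
  · rintro ⟨q, hq, hqw⟩
    by_contra h
    obtain ⟨h1, -, h2⟩ := not_accept_of_none_notMem h hqw
    have hq : q ∈ [(0, Track.top), (S, .count)] := hq
    simp only [List.mem_cons, List.not_mem_nil, or_false] at hq
    rcases hq with rfl | rfl
    · exact h1 rfl
    · exact h2 rfl
  · intro h
    obtain ⟨u, v, rfl, hu⟩ := List.eq_append_cons_of_mem h
    obtain ⟨u, rfl⟩ : ∃ u' : List Λ, u = u'.map some := by
      refine ⟨u.reduceOption, ?_⟩
      clear h
      induction u with
      | nil => rfl
      | cons a u ih =>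
        cases a with
        | none => simp at hu
        | some a =>
          rw [List.reduceOption_cons_of_some, List.map_cons, ← ih fun h => hu (by simp [h])]
    refine ⟨(0, .top), show _ ∈ [_, _] by simp, ?_⟩
    rw [List.append_cons]
    apply top_mem_eval
    rcases eq_tracePrefix_or V u with h | ⟨m, a, v, rfl, ha⟩
    · refine mem_eval_append (noacc_mem_eval u ?_) (hub_mem_step .noacc_top)
      rw [h]
      intro a ha
      obtain ⟨i, -, rfl⟩ := List.mem_map.1 ha
      exact hacc i
    · exact mem_eval_append (err_mem_eval hS hV ha v) (hub_mem_step .err_top)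

/-! ### The blow-up behind an accepting trace -/

theorem mem_eval_tracePrefix_none (hS : 1 ≤ S) (hV : T.IsTrace S x V) {i m : ℕ} (hi : i < m)
    (hacc : T.acc (V (i + 1))) (q : ℕ × Track Λ)
    (h : q ∈ (T.nfa S x).eval ((tracePrefix V m).map some ++ [none])) : q = (0, .kfree) := by
  obtain ⟨q₀, hq₀, ph, j, r, r', hat, hr, rfl, rfl⟩ := exists_of_mem_eval_append h
  have hinv := inv_of_mem_eval hS hV m _ hq₀
  generalize ha : (none : Option Λ) = a at hr
  cases hr <;> (try simp only [reduceCtorEq] at ha) <;> simp only [Inv, loc, Place.pos] at hinv ⊢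
  case noacc_top => exact (hinv i hi hacc).elim

/-- After an accepting prefix of the trace and a separator, the automaton looks for the letter
`first` at distance `S` from the end. -/
theorem mem_accepts_of_acc (hS : 1 ≤ S) (hV : T.IsTrace S x V) {i m : ℕ} (hi : i < m)
    (hacc : T.acc (V (i + 1))) (u : List Λ) :
    (tracePrefix V m).map some ++ none :: u.map some ∈ (T.nfa S x).accepts ↔
      ∃ v v', u = v ++ T.first :: v' ∧ v'.length = S := by
  rw [List.append_cons]
  have hk : ∀ v : List Λ, (0, .kfree) ∈
      (T.nfa S x).eval ((tracePrefix V m).map some ++ [none] ++ v.map some) := by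
    intro v
    induction v using List.reverseRecOn with
    | nil =>
      rw [List.map_nil, List.append_nil]
      exact mem_eval_append (mem_eval_tracePrefix hV m).1 (hub_mem_step .free_kfree)
    | append_singleton v b ih =>
      rw [List.map_append, ← List.append_assoc]
      exact mem_eval_append ih (hub_mem_step (.kfree b))
  constructor
  · rintro ⟨q, hq, hqw⟩
    have H : ∀ q ∈ (T.nfa S x).eval ((tracePrefix V m).map some ++ [none] ++ u.map some),
        q = (0, .kfree) ∨
          ∃ j v v', q = (j, .count) ∧ u = v ++ T.first :: v' ∧ v'.length = j := by
      clear hq hqw q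
      induction u using List.reverseRecOn with
      | nil =>
        intro q hq
        rw [List.map_nil, List.append_nil] at hq
        exact Or.inl (mem_eval_tracePrefix_none hS hV hi hacc q hq)
      | append_singleton u b ih =>
        intro q hq
        rw [List.map_append, ← List.append_assoc] at hq
        obtain ⟨q₀, hq₀, ph, j, r, r', hat, hr, rfl, rfl⟩ := exists_of_mem_eval_append hq
        have ih := ih _ hq₀
        generalize ha : some b = a at hr
        cases hr <;> simp only [loc, Place.pos, Prod.mk.injEq, reduceCtorEq, and_false, false_and,
          exists_false, or_self, Option.some.injEq] at ih ha ⊢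
        case kfree => simp
        case kfree_count => exact Or.inr ⟨0, u, [], by simp, by simp [ha], rfl⟩
        case count =>
          rcases ih with h | ⟨j', v, v', ⟨rfl, -⟩, rfl, rfl⟩
          · exact h.elim
          · exact Or.inr ⟨_, v, v' ++ [b], ⟨rfl, trivial⟩, by simp, by simp⟩
    have hq : q ∈ [(0, Track.top), (S, .count)] := hq
    simp only [List.mem_cons, List.not_mem_nil, or_false] at hq
    rcases hq with rfl | rfl
    · rcases H _ hqw with h | ⟨j, v, v', h, -⟩ <;> simp at h
    · rcases H _ hqw with h | ⟨j, v, v', h, hu, hv'⟩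
      · simp at h
      · exact ⟨v, v', hu, by simp_all⟩
  · rintro ⟨v, v', rfl, hv'⟩
    refine ⟨(S, .count), show _ ∈ [_, _] by simp, ?_⟩
    have H : ∀ v' : List Λ, v'.length ≤ S → (v'.length, .count) ∈ (T.nfa S x).eval
        ((tracePrefix V m).map some ++ [none] ++ (v ++ T.first :: v').map some) := by
      intro v'
      induction v' using List.reverseRecOn with
      | nil =>
        intro _
        rw [List.map_append, ← List.append_assoc]
        exact mem_eval_append (hk v) (hub_mem_step .kfree_count)
      | append_singleton v' b ih =>
        intro hlen
        rw [List.length_append, List.length_singleton] at hlen ⊢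
        have h := mem_eval_append (ih (by omega))
          (round_mem_step (show v'.length < S by omega) (.count _ b))
        simpa [loc, Place.pos] using h
    exact hv' ▸ H v' hv'.le

/-- The number of states of a deterministic automaton for the same language is at least
exponential in `S` if the trace contains an accepting letter: such an automaton has to remember
which of the last `S + 1` letters are `first`. -/
theorem two_pow_le_card (hS : 1 ≤ S) (hV : T.IsTrace S x V) {i : ℕ} (hacc : T.acc (V (i + 1)))
    {σ : Type} [Fintype σ] (D : DFA (Option Λ) σ) (hD : D.accepts = (T.nfa S x).accepts) :
    2 ^ (S + 1) ≤ Fintype.card σ := by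
  classical
  -- A state determines the positions of `first` among the last `S + 1` letters: the position `j`
  -- is tested by appending `j` further letters.
  let F : σ → Fin (S + 1) → Bool := fun q j =>
    decide (D.evalFrom q (List.replicate j (some T.first)) ∈ D.accept)
  have hF : Function.Surjective F := by
    intro b
    let u : List Λ := List.ofFn fun j => bif b j then T.first else T.cell none
    refine ⟨D.eval ((tracePrefix V (i + 1)).map some ++ none :: u.map some), ?_⟩
    funext j
    have h := mem_accepts_of_acc hS hV (Nat.lt_succ_self i) hacc (u ++ List.replicate j T.first)
    rw [← hD, List.map_append, List.map_replicate, ← List.cons_append, ← List.append_assoc,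
      DFA.mem_accepts, DFA.eval, DFA.evalFrom_of_append] at h
    have h' : (∃ v v', u ++ List.replicate j T.first = v ++ T.first :: v' ∧ v'.length = S) ↔
        b j = true := by
      have hu : u.length = S + 1 := by simp [u]
      have hj := j.isLt
      have huj : (u ++ List.replicate j T.first)[(j : ℕ)]? =
          some (bif b j then T.first else T.cell none) := by
        rw [List.getElem?_append_left (by omega)]
        rw [List.getElem?_ofFn, dif_pos j.isLt]
      constructor
      · rintro ⟨v, v', he, hv'⟩
        have hlen := congrArg List.length he
        simp only [List.length_append, List.length_replicate, List.length_cons] at hlen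
        have hvj : v.length = j := by omega
        rw [he, ← hvj, List.getElem?_append_right le_rfl] at huj
        cases hb : b j
        · simp [hvj, hb] at huj
          exact absurd huj.symm (T.cell_ne_first none)
        · rfl
      · intro hb
        rw [hb, cond_true] at huj
        obtain ⟨hj', huj⟩ := List.getElem?_eq_some_iff.1 huj
        refine ⟨(u ++ List.replicate j T.first).take j,
          (u ++ List.replicate j T.first).drop (j + 1), ?_, ?_⟩
        · conv_lhs => rw [← List.take_append_drop j (u ++ List.replicate j T.first),
            List.drop_eq_getElem_cons hj', huj]
        · simp [hu]
          omega
    rw [Bool.eq_iff_iff, ← h', ← h]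
    exact decide_eq_true_iff
  simpa using Fintype.card_le_of_surjective F hF

end TraceSystem

/-! ### The traces of a Turing machine -/

namespace SpaceTM

/-- The letters of the words that describe computations: `none` separates successive
configurations, `some none` stands in front of the input, and the other letters are the tape cells
with the state of the machine at the position of the head. -/
abbrev Letter (M : SpaceTM) : Type :=
  Option (Option (M.Symbol × Option M.State))

/-- The machine halts in the state `q`. -/
def Halts (M : SpaceTM) (q : M.State) : Prop :=
  q = M.accept ∨ q = M.reject

open Classical in
/-- The state in which the head leaves the cell `a` in the direction `d`, if it does so. -/
noncomputable def leaving (M : SpaceTM) (d : Turing.Dir) : M.Letter → Option M.State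
  | some (some (γ, some q)) =>
      if M.Halts q then none
      else if (M.trans q γ).2.2 = d then some (M.trans q γ).1 else none
  | _ => none

open Classical in
/-- The cell `b` with the neighbours `a` and `c` after one step. In front of the first
configuration there is a block without a state, from which the head enters the leftmost cell. -/
noncomputable def nextLetter (M : SpaceTM) (a b c : M.Letter) : M.Letter :=
  match b with
  | some (some (γ, some q)) =>
      if M.Halts q then b
      else some (some ((M.trans q γ).2.1,
        if (M.trans q γ).2.2 = Turing.Dir.left ∧ a = none then some (M.trans q γ).1 else none))
  | some (some (γ, none)) =>
      some (some (γ, if a = some none then some M.start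
        else (M.leaving .right a).or (M.leaving .left c)))
  | _ => none

/-- The computations of a machine as words in which each letter is determined locally. -/
noncomputable def traceSystem (M : SpaceTM) : TraceSystem M.Letter where
  next := M.nextLetter
  cell o := some (some (M.sym o, none))
  first := some none
  acc a := ∃ γ, a = some (some (γ, some M.accept))
  cell_ne_first := by simp

open Classical in
/-- The cell `i` in the configuration `c`. -/
noncomputable def cellAt {M : SpaceTM} (c : M.Cfg) (i : ℕ) : M.Letter :=
  some (some (c.tape i, if c.head = i then some c.state else none))

/-- The letter `nextLetter` describes a step of the machine, also at the left end of the tape and at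
the last cell of the block, whose right neighbour is the separator of the next block: the head
never leaves the block. -/
theorem nextLetter_cellAt {M : SpaceTM} {c : M.Cfg} {S r : ℕ} (hc : c.head < S)
    (hr : r < S) :
    M.nextLetter (if r = 0 then none else cellAt c (r - 1)) (cellAt c r)
      (if r + 1 < S then cellAt c (r + 1) else none) = cellAt (M.step c) r := by
  by_cases hh : c.state = M.accept ∨ c.state = M.reject
  · have hs : M.step c = c := if_pos hh
    have hl : ∀ d i, M.leaving d (cellAt c i) = none := by
      intro d i
      by_cases hi : c.head = i
      · simp [cellAt, hi, leaving, Halts, hh]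
      · simp [cellAt, hi, leaving]
    rw [hs]
    by_cases hi : c.head = r
    · simp [cellAt, hi, nextLetter, Halts, hh]
    · have h1 : M.leaving .right (if r = 0 then none else cellAt c (r - 1)) = none := by
        split_ifs
        · rfl
        · exact hl _ _
      have h2 : M.leaving .left (if r + 1 < S then cellAt c (r + 1) else none) = none := by
        split_ifs
        · exact hl _ _
        · rfl
      have h3 : (if r = 0 then (none : M.Letter) else cellAt c (r - 1)) ≠ some none := by
        split_ifs <;> simp [cellAt]
      have e : cellAt c r = some (some (c.tape r, none)) := by simp [cellAt, hi]
      simp only [e, nextLetter, if_neg h3, h1, h2, Option.or_none]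
  · have hs : M.step c = _ := if_neg hh
    have hhead : (M.step c).head = moveHead c.head (M.trans c.state (c.tape c.head)).2.2 := by
      rw [hs]
    have hstate : (M.step c).state = (M.trans c.state (c.tape c.head)).1 := by rw [hs]
    have htape : (M.step c).tape =
        Function.update c.tape c.head (M.trans c.state (c.tape c.head)).2.1 := by rw [hs]
    have hl : ∀ d i, M.leaving d (cellAt c i) =
        if c.head = i ∧ (M.trans c.state (c.tape c.head)).2.2 = d then
          some (M.trans c.state (c.tape c.head)).1 else none := by
      intro d i
      by_cases hi : c.head = i
      · subst hi
        simp [cellAt, leaving, Halts, hh]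
      · simp [cellAt, hi, leaving]
    by_cases hi : c.head = r
    · subst hi
      have e : cellAt c c.head = some (some (c.tape c.head, some c.state)) := by simp [cellAt]
      have e' : cellAt (M.step c) c.head = some (some ((M.trans c.state (c.tape c.head)).2.1,
          if moveHead c.head (M.trans c.state (c.tape c.head)).2.2 = c.head then
            some (M.trans c.state (c.tape c.head)).1 else none)) := by
        simp [cellAt, hhead, hstate, htape]
      rw [e, e']
      have hwall : (if c.head = 0 then (none : M.Letter) else cellAt c (c.head - 1)) = none ↔
          c.head = 0 := by
        split_ifs with h <;> simp [cellAt, h]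
      simp only [nextLetter, if_neg (show ¬ M.Halts c.state from hh), hwall]
      rcases (M.trans c.state (c.tape c.head)).2.2 with _ | _
      · simp only [moveHead, true_and]
        by_cases h0 : c.head = 0
        · simp [h0]
        · simp [h0, show c.head - 1 ≠ c.head by omega]
      · simp [moveHead]
    · have e : cellAt c r = some (some (c.tape r, none)) := by simp [cellAt, hi]
      have e' : cellAt (M.step c) r = some (some (c.tape r,
          if moveHead c.head (M.trans c.state (c.tape c.head)).2.2 = r then
            some (M.trans c.state (c.tape c.head)).1 else none)) := by
        simp [cellAt, hhead, hstate, htape, Function.update_of_ne (Ne.symm hi)]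
      rw [e, e']
      have h3 : (if r = 0 then (none : M.Letter) else cellAt c (r - 1)) ≠ some none := by
        split_ifs <;> simp [cellAt]
      have h1 : M.leaving .right (if r = 0 then none else cellAt c (r - 1)) =
          if c.head + 1 = r ∧ (M.trans c.state (c.tape c.head)).2.2 = .right then
            some (M.trans c.state (c.tape c.head)).1 else none := by
        rcases r with _ | r
        · simp [leaving]
        · simp [hl]
      have h2 : M.leaving .left (if r + 1 < S then cellAt c (r + 1) else none) =
          if c.head = r + 1 ∧ (M.trans c.state (c.tape c.head)).2.2 = .left then
            some (M.trans c.state (c.tape c.head)).1 else none := by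
        split_ifs with hrS h
        · rw [hl, if_pos h]
        · rw [hl, if_neg h]
        · omega
        · rfl
      simp only [nextLetter, if_neg h3, h1, h2]
      rcases (M.trans c.state (c.tape c.head)).2.2 with _ | _
      · simp only [moveHead, reduceCtorEq, and_false, if_false, and_true, Option.none_or]
        by_cases h0 : c.head = r + 1
        · simp [h0]
        · simp [h0, show c.head - 1 ≠ r by omega]
      · simp only [moveHead, reduceCtorEq, and_false, if_false, and_true, Option.or_none]
        by_cases h0 : c.head + 1 = r <;> simp [h0]

/-- Letter `r` of block `t` of the trace on input `x`. -/
noncomputable def blockLetter (M : SpaceTM) (x : List Bool) : ℕ → ℕ → M.Letter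
  | 0, 0 => some none
  | 0, r + 1 => some (some (M.sym x[r]?, none))
  | _ + 1, 0 => none
  | t + 1, r + 1 => cellAt (M.run x t) r

/-- The trace on input `x` with block length `S + 1`, with the additional letter in front. -/
noncomputable def trace (M : SpaceTM) (S : ℕ) (x : List Bool) : ℕ → M.Letter
  | 0 => some none
  | i + 1 => M.blockLetter x (i / (S + 1)) (i % (S + 1))

/-- The letter of the trace at position `r` of block `t`. The shift by one is due to the additional
letter in front. -/
theorem trace_block (M : SpaceTM) {S : ℕ} (x : List Bool) {t r : ℕ} (hr : r ≤ S) :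
    M.trace S x ((S + 1) * t + r + 1) = M.blockLetter x t r := by
  have h1 : ((S + 1) * t + r) / (S + 1) = t := by
    rw [Nat.mul_add_div (by omega), Nat.div_eq_of_lt (by omega), add_zero]
  have h2 : ((S + 1) * t + r) % (S + 1) = r := by
    rw [Nat.mul_add_mod, Nat.mod_eq_of_lt (by omega)]
  rw [trace, h1, h2]

theorem run_succ (M : SpaceTM) (x : List Bool) (t : ℕ) :
    M.run x (t + 1) = M.step (M.run x t) :=
  Function.iterate_succ_apply' _ _ _

theorem isTrace_trace {M : SpaceTM} {S : ℕ} {x : List Bool}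
    (h : ∀ t, (M.run x t).head < S) : M.traceSystem.IsTrace S x (M.trace S x) where
  zero := rfl
  one := by simp [trace, blockLetter, traceSystem]
  init i hi := by
    have h := M.trace_block x (t := 0) (show i + 1 ≤ S by omega)
    rw [Nat.mul_zero, Nat.zero_add] at h
    exact h
  next i := by
    obtain ⟨t, r, hr, rfl⟩ : ∃ t r, r ≤ S ∧ i = (S + 1) * t + r :=
      ⟨i / (S + 1), i % (S + 1), Nat.lt_succ_iff.1 (Nat.mod_lt _ (by omega)),
        (Nat.div_add_mod _ _).symm⟩
    rw [show (S + 1) * t + r + S + 2 = (S + 1) * (t + 1) + r + 1 by ring, M.trace_block x hr,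
      M.trace_block x hr]
    rcases r with _ | r
    · rcases t with _ | t <;> rfl
    have h2 : M.trace S x ((S + 1) * t + (r + 1) + 2) =
        if r + 1 < S then M.blockLetter x t (r + 2) else none := by
      split_ifs with h
      · rw [← M.trace_block x (show r + 2 ≤ S by omega)]
        rfl
      · rw [show (S + 1) * t + (r + 1) + 2 = (S + 1) * (t + 1) + 0 + 1 by
            rw [Nat.mul_add]; omega, M.trace_block x (Nat.zero_le _)]
        rfl
    rw [h2, ← Nat.add_assoc, M.trace_block x (show r ≤ S by omega)]
    rcases t with _ | t
    · have h2 : M.leaving .left (if r + 1 < S then M.blockLetter x 0 (r + 2) else none) = none := by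
        split_ifs <;> rfl
      rcases r with _ | r
      · simp [blockLetter, traceSystem, nextLetter, cellAt, run, init]
      · simp only [blockLetter, traceSystem, nextLetter] at h2 ⊢
        rw [h2]
        simp [cellAt, run, init, leaving]
    · have h3 : M.blockLetter x (t + 1) r =
          if r = 0 then none else cellAt (M.run x t) (r - 1) := by
        rcases r with _ | r <;> simp [blockLetter]
      rw [h3]
      change cellAt (M.run x (t + 1)) r = M.nextLetter _ (cellAt (M.run x t) r)
        (if r + 1 < S then cellAt (M.run x t) (r + 1) else none)
      rw [run_succ]
      exact (nextLetter_cellAt (h t) (by omega)).symm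

theorem run_state_of_halts {M : SpaceTM} {x : List Bool} {t : ℕ} (h : M.Halts (M.run x t).state)
    (d : ℕ) : (M.run x (t + d)).state = (M.run x t).state := by
  induction d with
  | zero => rfl
  | succ d ih =>
    rw [← ih] at h ⊢
    rw [← Nat.add_assoc, run_succ, show M.step _ = _ from if_pos h]

/-- A machine accepts if and only if its trace contains an accepting letter. -/
theorem mem_iff_exists_acc {M : SpaceTM} {L : Language Bool} {s : ℕ → ℕ}
    (hM : M.DecidesInSpace L s) {S : ℕ} {x : List Bool} (hS : s x.length ≤ S) :
    x ∈ L ↔ ∃ i, M.traceSystem.acc (M.trace S x (i + 1)) := by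
  obtain ⟨h1, h2, h3⟩ := hM x
  constructor
  · intro hx
    obtain ⟨t, ht⟩ := h1 hx
    have hh := h3 t
    refine ⟨(S + 1) * (t + 1) + ((M.run x t).head + 1), (M.run x t).tape (M.run x t).head, ?_⟩
    rw [M.trace_block x (show (M.run x t).head + 1 ≤ S by omega)]
    simp [blockLetter, cellAt, ht]
  · rintro ⟨i, γ, hi⟩
    by_contra hx
    obtain ⟨t, ht⟩ := h2 hx
    rw [trace] at hi
    generalize i / (S + 1) = t', i % (S + 1) = r at hi
    rcases t' with _ | t' <;> rcases r with _ | r <;> simp [blockLetter, cellAt] at hi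
    have e1 := run_state_of_halts (x := x) (t := t) (Or.inr ht) t'
    have e2 := run_state_of_halts (x := x) (t := t') (Or.inl hi.2.2) t
    rw [Nat.add_comm, e2, ht, hi.2.2] at e1
    exact M.accept_ne_reject e1

end SpaceTM

/-! ### A program that prints words with unary counters -/

namespace StackProg

/-- The stacks of the printing program. -/
inductive Stk
  | inp
  | base
  | tmp
  | pow
  | prod
  | cnt
  | out
  deriving DecidableEq

instance : Fintype Stk :=
  ⟨{.inp, .base, .tmp, .pow, .prod, .cnt, .out}, by rintro (_ | _ | _ | _ | _ | _ | _) <;> simp⟩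

/-- Programs on the stacks `Stk`, all of which have the alphabet `Bool`. -/
abbrev BoolProg : Type := StackProg (fun _ : Stk => Bool) Bool

/-- The contents of the stacks. -/
abbrev Store : Type := Stk → List Bool

/-- `BoolProg` programs store the symbols in the register as they are. -/
abbrev BoolProg.Runs (p : BoolProg) (v : Option Bool) (S S' : Store) (t : ℕ) : Prop :=
  StackProg.Runs (fun _ b => b) p v S S' t

/-- The number `n` in unary. -/
abbrev ones (n : ℕ) : List Bool := List.replicate n true

theorem Runs.congr {K τ : Type} {Γ : K → Type} [DecidableEq K] {rd : ∀ k, Γ k → τ}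
    {p : StackProg Γ τ} {v : Option τ} {S₁ S₁' S₂ S₂' : ∀ k, List (Γ k)} {t t' : ℕ}
    (h : Runs rd p v S₁ S₂ t) (h₁ : S₁ = S₁') (h₂ : S₂ = S₂') (ht : t ≤ t') :
    Runs rd p v S₁' S₂' t' := by
  subst h₁ h₂
  exact h.mono ht

theorem runs_push (k : Stk) (f : Option Bool → Bool) (v : Option Bool) (S : Store) :
    BoolProg.Runs (push k f) v S (Function.update S k (f v :: S k)) 0 :=
  Runs.push (rd := fun (_ : Stk) (b : Bool) => b) f

/-- Push a word on a stack, beginning with its last letter. -/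
def pushWord (k : Stk) : List Bool → BoolProg
  | [] => skip
  | b :: w => seq (pushWord k w) (push k fun _ => b)

theorem runs_pushWord (k : Stk) (w : List Bool) (v : Option Bool) (S : Store) :
    BoolProg.Runs (pushWord k w) v S (Function.update S k (w ++ S k)) 0 := by
  induction w generalizing v with
  | nil => exact Runs.skip.congr rfl (by simp) le_rfl
  | cons b w ih =>
    refine (Runs.seq (ih v) fun v => runs_push _ _ v _).congr rfl ?_ le_rfl
    simp

/-- Empty the stack `k`, and for each of its letters push `p` letters on the stack `a` and `q`
letters on the stack `b`. -/
def spread (k a : Stk) (p : ℕ) (b : Stk) (q : ℕ) : BoolProg :=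
  loop k (seq (pushWord a (ones p)) (pushWord b (ones q)))

theorem runs_spread {k a b : Stk} (hka : k ≠ a) (hkb : k ≠ b) (hab : a ≠ b) (p q : ℕ)
    (v : Option Bool) (S : Store) :
    BoolProg.Runs (spread k a p b q) v S
      (Function.update (Function.update (Function.update S k [])
        a (ones (p * (S k).length) ++ S a)) b (ones (q * (S k).length) ++ S b))
      ((S k).length + 1) := by
  have h := Runs.loop_rounds (rd := fun _ b => b) (k := k) (l := S k) (t := 0) (v := v)
    (p := seq (pushWord a (ones p)) (pushWord b (ones q)))
    (fun i => Function.update (Function.update (Function.update S k ((S k).drop i))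
      a (ones (p * i) ++ S a)) b (ones (q * i) ++ S b))
    (by intro i _; simp [hka, hkb])
    (by
      intro i hi
      refine (Runs.seq (runs_pushWord _ _ _ _) fun v => runs_pushWord _ _ v _).congr rfl ?_ le_rfl
      have h1 : ∀ p, ones (p * (i + 1)) = ones p ++ ones (p * i) := fun p => by
        rw [List.replicate_append_replicate, Nat.mul_succ, Nat.add_comm]
      funext k'
      by_cases hb : k' = b
      · subst hb; simp [Ne.symm hab, Ne.symm hkb]; rw [h1, List.append_assoc]
      · by_cases ha : k' = a
        · subst ha; simp [hab, Ne.symm hka]; rw [h1, List.append_assoc]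
        · by_cases hk : k' = k
          · subst hk; simp [hb, ha]
          · simp [hb, ha, hk])
  refine h.congr ?_ ?_ (by simp)
  · simp
  · simp

/-! #### Powers -/

/-- Multiply the length of the stack `pow` by that of the stack `base`. -/
def mulProg : BoolProg :=
  seq (loop .pow (seq (spread .base .tmp 1 .prod 1) (spread .tmp .base 1 .prod 0)))
    (spread .prod .pow 1 .tmp 0)

theorem runs_mulProg {m a : ℕ} {S : Store} (hb : S .base = ones m) (hp : S .pow = ones a)
    (ht : S .tmp = []) (hr : S .prod = []) (v : Option Bool) :
    BoolProg.Runs mulProg v S (Function.update S .pow (ones (m * a)))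
      (a * (2 * m + 3) + m * a + 2) := by
  have h := Runs.loop_rounds (rd := fun _ b => b) (k := Stk.pow) (l := ones a) (t := 2 * m + 2)
    (v := v) (p := seq (spread .base .tmp 1 .prod 1) (spread .tmp .base 1 .prod 0))
    (fun i => Function.update (Function.update S .pow (ones (a - i))) .prod (ones (m * i)))
    (by intro i _; simp)
    (by
      intro i hi
      refine (Runs.seq (runs_spread (by decide) (by decide) (by decide) 1 1 _ _) fun v =>
        runs_spread (by decide) (by decide) (by decide) 1 0 v _).congr rfl ?_ ?_
      · funext k
        cases k <;> simp [hb, ht, Nat.mul_succ, Nat.add_comm, Nat.sub_add_eq]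
      · simp [hb, ht]
        omega)
  refine (Runs.seq h fun v =>
    runs_spread (by decide) (by decide) (by decide) 1 0 v _).congr ?_ ?_ ?_
  · funext k
    cases k <;> simp [hp, hr]
  · funext k
    cases k <;> simp [ht, hr]
  · exact le_of_eq (by simp; ring)

/-- If the stack `base` has `m` letters, put `m ^ d` letters on the stack `pow`. -/
def powProg : ℕ → BoolProg
  | 0 => pushWord .pow [true]
  | d + 1 => seq (powProg d) mulProg

theorem runs_powProg (d : ℕ) : ∃ P : Polynomial ℕ, ∀ (m : ℕ) (S : Store) (v : Option Bool),
    S .base = ones m → S .pow = [] → S .tmp = [] → S .prod = [] →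
    BoolProg.Runs (powProg d) v S (Function.update S .pow (ones (m ^ d))) (P.eval m) := by
  induction d with
  | zero =>
    refine ⟨0, fun m S v _ hp _ _ => (runs_pushWord _ _ v S).congr rfl ?_ (Nat.zero_le _)⟩
    simp [hp]
  | succ d ih =>
    obtain ⟨P, hP⟩ := ih
    refine ⟨P + (Polynomial.X ^ d * (2 * Polynomial.X + 3) + Polynomial.X * Polynomial.X ^ d + 2),
      fun m S v hb hp ht hr => ?_⟩
    refine (Runs.seq (hP m S v hb hp ht hr) fun v =>
      runs_mulProg (m := m) (a := m ^ d) ?_ ?_ ?_ ?_ v).congr rfl ?_ ?_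
    · simpa using hb
    · simp
    · simpa using ht
    · simpa using hr
    · simp [pow_succ']
    · simp

/-! #### Printing -/

/-- The word that a template stands for: `some b` is the letter `b`, and `none` stands for
`C * j` letters `true`. -/
def expand (C j : ℕ) (w : List (Option Bool)) : List Bool :=
  w.flatMap fun
    | none => ones (C * j)
    | some b => [b]

/-- Print the word that a template stands for, where `j` is the length of the stack `cnt`. -/
def emit (C : ℕ) : List (Option Bool) → BoolProg
  | [] => skip
  | some b :: w => seq (emit C w) (push .out fun _ => b)
  | none :: w => seq (emit C w) (seq (spread .cnt .out C .tmp 1) (spread .tmp .cnt 1 .out 0))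

theorem runs_emit (C : ℕ) {j : ℕ} (w : List (Option Bool)) {S : Store} (hc : S .cnt = ones j)
    (ht : S .tmp = []) (v : Option Bool) :
    BoolProg.Runs (emit C w) v S (Function.update S .out (expand C j w ++ S .out))
      (w.length * (2 * j + 2)) := by
  induction w generalizing v with
  | nil => exact Runs.skip.congr rfl (by simp [expand]) (Nat.zero_le _)
  | cons b w ih =>
    cases b with
    | some b =>
      refine (Runs.seq (ih v) fun v => runs_push _ _ v _).congr rfl ?_ ?_
      · simp [expand]
      · simp only [List.length_cons, Nat.add_mul]
        omega
    | none =>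
      refine (Runs.seq (ih v) fun v => Runs.seq
        (runs_spread (by decide) (by decide) (by decide) C 1 v _) fun v =>
          runs_spread (by decide) (by decide) (by decide) 1 0 v _).congr rfl ?_ ?_
      · funext k
        cases k <;> simp [hc, ht, expand]
      · simp [hc, ht, Nat.add_mul]
        omega

/-- The word that `printProg` prints on input `x`, where `n` is the number of rounds. -/
def printed (C : ℕ) (hd : List (Option Bool)) (rnd : Option Bool → List (Option Bool)) (n : ℕ)
    (x : List Bool) : List Bool :=
  expand C n hd ++
    ((List.range n).reverse.flatMap fun j => expand C j (rnd x[j]?)) ++ [false]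

/-- One round: read a letter of the input, print the template for it, and increase the counter. -/
def roundProg (C : ℕ) (rnd : Option Bool → List (Option Bool)) : BoolProg :=
  seq (pop .inp (ite Option.isNone (emit C (rnd none))
    (ite (fun v => v = some true) (emit C (rnd (some true))) (emit C (rnd (some false))))))
    (push .cnt fun _ => true)

theorem runs_roundProg (C : ℕ) (rnd : Option Bool → List (Option Bool)) {j : ℕ} {x : List Bool}
    {S : Store} (hi : S .inp = x.drop j) (hc : S .cnt = ones j) (ht : S .tmp = [])
    (v : Option Bool) :
    BoolProg.Runs (roundProg C rnd) v S
      (Function.update (Function.update (Function.update S .inp (x.drop (j + 1)))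
        .cnt (ones (j + 1))) .out (expand C j (rnd x[j]?) ++ S .out))
      ((rnd none ++ rnd (some true) ++ rnd (some false)).length * (2 * j + 2)) := by
  have hhead : (S .inp).head?.map (fun b => b) = x[j]? := by simp [hi]
  have htail : (S .inp).tail = x.drop (j + 1) := by simp [hi]
  have hemit := fun o w => runs_emit C (j := j) (rnd o)
    (S := Function.update S .inp (x.drop (j + 1))) (by simpa using hc) (by simpa using ht) w
  have hlen : ∀ o, (rnd o).length ≤ (rnd none ++ rnd (some true) ++ rnd (some false)).length := by
    rintro (_ | _ | _) <;> simp <;> omega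
  refine (Runs.seq (S' := Function.update (Function.update S .inp (x.drop (j + 1))) .out
    (expand C j (rnd x[j]?) ++ S .out))
    (t := (rnd none ++ rnd (some true) ++ rnd (some false)).length * (2 * j + 2)) (t' := 0)
    (Runs.pop ?_) fun v => runs_push _ _ v _).congr rfl ?_ le_rfl
  · rw [hhead, htail]
    generalize x[j]? = o
    have h : BoolProg.Runs (emit C (rnd o)) o (Function.update S .inp (x.drop (j + 1)))
        (Function.update (Function.update S .inp (x.drop (j + 1))) .out
          (expand C j (rnd o) ++ S .out))
        ((rnd none ++ rnd (some true) ++ rnd (some false)).length * (2 * j + 2)) :=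
      (hemit o o).congr rfl (by simp) (Nat.mul_le_mul_right _ (hlen o))
    rcases o with _ | _ | _
    · exact Runs.ite h
    · exact Runs.ite (Runs.ite h)
    · exact Runs.ite (Runs.ite h)
  · funext k
    cases k <;> simp [hc, List.replicate_succ]

/-- Copy the input to the stack `base` as a unary number, increased by `c`. -/
def setupProg (c : ℕ) : BoolProg :=
  seq (loop .inp (seq (push .tmp fun v => v.getD true) (push .base fun _ => true)))
    (seq (loop .tmp (push .inp fun v => v.getD true)) (pushWord .base (ones c)))

theorem runs_setupProg (c : ℕ) {x : List Bool} {S : Store} (hi : S .inp = x)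
    (hb : S .base = []) (ht : S .tmp = []) (v : Option Bool) :
    BoolProg.Runs (setupProg c) v S (Function.update S .base (ones (x.length + c)))
      (2 * x.length + 2) := by
  have h1 := Runs.loop_rounds (rd := fun _ b => b) (k := Stk.inp) (l := x) (t := 0)
    (v := v) (p := seq (push .tmp fun v => v.getD true) (push .base fun _ => true))
    (fun i => Function.update (Function.update (Function.update S .inp (x.drop i))
      .tmp (x.take i).reverse) .base (ones i))
    (by intro i _; simp)
    (by
      intro i hi
      refine (Runs.seq (runs_push _ _ _ _) fun v => runs_push _ _ v _).congr rfl ?_ le_rfl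
      have e : (x.take (i + 1)).reverse = x[i] :: (x.take i).reverse := by
        rw [List.take_succ_eq_append_getElem hi, List.reverse_append]
        rfl
      funext k
      cases k <;> simp [List.replicate_succ, e])
  have h2 : ∀ v, BoolProg.Runs _ v _ _ _ := fun v =>
    Runs.loop_rounds (rd := fun _ b => b) (k := Stk.tmp) (l := x.reverse) (t := 0)
    (v := v) (p := push .inp fun v => v.getD true)
    (fun i => Function.update (Function.update (Function.update S .inp
      (x.reverse.take i).reverse) .tmp (x.reverse.drop i)) .base (ones x.length))
    (by intro i _; simp)
    (by
      intro i hi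
      refine (runs_push _ _ _ _).congr rfl ?_ le_rfl
      have e : (x.reverse.take (i + 1)).reverse = x.reverse[i] :: (x.reverse.take i).reverse := by
        rw [List.take_succ_eq_append_getElem hi, List.reverse_append]
        rfl
      rw [e]
      funext k
      cases k <;> simp)
  refine (Runs.seq (h1.congr ?_ ?_ le_rfl) fun v => Runs.seq (h2 v) fun v =>
    runs_pushWord _ _ v _).congr rfl ?_ ?_
  · funext k
    cases k <;> simp [hi, hb, ht]
  · funext k
    cases k <;> simp
  · funext k
    cases k <;> simp [hi, ht, Nat.add_comm, List.take_of_length_le]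
  · simp
    omega

/-- Print the word `printed` with `(n + c) ^ d` rounds on inputs of length `n`. -/
def printProg (C : ℕ) (hd : List (Option Bool)) (rnd : Option Bool → List (Option Bool))
    (c d : ℕ) : BoolProg :=
  seq (setupProg c) <| seq (powProg d) <| seq (push .out fun _ => false) <|
    seq (loop .pow (roundProg C rnd)) <| seq (emit C hd) <|
      seq (spread .base .tmp 0 .prod 0) (spread .cnt .tmp 0 .prod 0)

theorem runs_printProg (C : ℕ) (hd : List (Option Bool))
    (rnd : Option Bool → List (Option Bool)) {c d : ℕ} (hcd : ∀ n, n ≤ (n + c) ^ d) :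
    ∃ P : Polynomial ℕ, ∀ x : List Bool,
      BoolProg.Runs (printProg C hd rnd c d) none (Function.update (fun _ => []) .inp x)
        (Function.update (fun _ => []) .out (printed C hd rnd ((x.length + c) ^ d) x))
        (P.eval x.length) := by
  obtain ⟨P, hP⟩ := runs_powProg d
  let N : Polynomial ℕ := Polynomial.X + Polynomial.C c
  let Q : Polynomial ℕ := N ^ d
  let len : ℕ := (rnd none ++ rnd (some true) ++ rnd (some false)).length
  -- The summands bound the times of the parts of the program in their order.
  refine ⟨(2 * Polynomial.X + 2) + (P.comp N + (0 +
    ((Q * (Polynomial.C len * (2 * Q + 2) + 1) + 1) + (Polynomial.C hd.length * (2 * Q + 2) + ((N + 1) + (Q + 1)))))), fun x => ?_⟩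
  obtain ⟨n, hn⟩ : ∃ n, n = (x.length + c) ^ d := ⟨_, rfl⟩
  have hN : N.eval x.length = x.length + c := by simp [N]
  have hQ : Q.eval x.length = n := by simp [Q, hN, hn]
  simp only [Polynomial.eval_add, Polynomial.eval_mul, Polynomial.eval_comp, Polynomial.eval_X,
    Polynomial.eval_C, Polynomial.eval_one, Polynomial.eval_ofNat, Polynomial.eval_zero, hN, hQ]
  have hxn : x.length ≤ n := hn ▸ hcd _
  let S₀ : Store := Function.update (Function.update (fun _ => []) .inp x)
    .base (ones (x.length + c))
  let T : ℕ → Store := fun i => Function.update (Function.update (Function.update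
    (Function.update S₀ .pow (ones (n - i))) .inp (x.drop i)) .cnt (ones i))
    .out (((List.range i).reverse.flatMap fun j => expand C j (rnd x[j]?)) ++ [false])
  refine Runs.seq (runs_setupProg c (x := x) (by simp) (by simp) (by simp) none) fun v => ?_
  refine Runs.seq (hP _ S₀ v (by simp [S₀]) (by simp [S₀]) (by simp [S₀]) (by simp [S₀]))
    fun v => ?_
  refine Runs.seq (runs_push _ _ _ _) fun v => ?_
  have hloop : BoolProg.Runs (loop .pow (roundProg C rnd)) v (T 0) (T n)
      (n * (len * (2 * n + 2) + 1) + 1) := by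
    have h := Runs.loop_rounds (rd := fun _ b => b) (k := Stk.pow) (l := ones n)
      (t := len * (2 * n + 2)) (v := v) (p := roundProg C rnd) T (by intro i _; simp [T]) ?_
    · simpa using h
    intro i hi
    have hi : i < n := by simpa using hi
    refine (runs_roundProg C rnd (j := i) (x := x) ?_ ?_ ?_ _).congr rfl ?_ ?_
    · simp [T]
    · simp [T]
    · simp [T, S₀]
    · funext k
      cases k <;> simp [T, List.range_succ, Nat.sub_add_eq]
    · exact Nat.mul_le_mul_left _ (by omega)
  refine Runs.seq (hloop.congr ?_ rfl le_rfl) fun v => ?_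
  · funext k
    cases k <;> simp [T, S₀, hn]
  refine Runs.seq (runs_emit C (j := n) hd (by simp [T]) (by simp [T, S₀]) v) fun v => ?_
  refine (Runs.seq (runs_spread (by decide) (by decide) (by decide) 0 0 v _) fun v =>
    runs_spread (by decide) (by decide) (by decide) 0 0 v _).congr rfl ?_ ?_
  -- The rounds have consumed the whole input, since there are at least as many of them as letters.
  · funext k
    cases k <;> simp [T, S₀, printed, hn, List.drop_eq_nil_of_le (hn ▸ hxn)]
  · simp [T, S₀]

end StackProg

/-! ### The error-detecting automata as finite objects -/

namespace TraceSystem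

open StackProg (ones expand printed)

variable {Λ : Type} [Fintype Λ]

/-- The number of tracks. -/
def numTracks (Λ : Type) [Fintype Λ] : ℕ :=
  Fintype.card (Track Λ)

/-- The numbering of the tracks. -/
noncomputable def trackEquiv : Track Λ ≃ Fin (numTracks Λ) :=
  Fintype.equivFin _

/-- The numbering of the letters. -/
noncomputable def letterEquiv : Option Λ ≃ Fin (Fintype.card (Option Λ)) :=
  Fintype.equivFin _

/-- The number of a state; it is meant for states with an index up to `S`. -/
noncomputable def stateCode (S : ℕ) (q : ℕ × Track Λ) : Fin ((S + 1) * numTracks Λ) :=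
  finProdFinEquiv (Fin.ofNat (S + 1) q.1, trackEquiv q.2)

theorem val_stateCode {S : ℕ} {q : ℕ × Track Λ} (hq : q.1 ≤ S) :
    (stateCode S q : ℕ) = trackEquiv q.2 + numTracks Λ * q.1 := by
  simp [stateCode, finProdFinEquiv, Nat.mod_eq_of_lt (Nat.lt_succ_of_le hq)]

theorem stateCode_inj {S : ℕ} {q q' : ℕ × Track Λ} (hq : q.1 ≤ S) (hq' : q'.1 ≤ S)
    (h : stateCode S q = stateCode S q') : q = q' := by
  have h := finProdFinEquiv.injective h
  rw [Prod.mk.injEq, Fin.ext_iff] at h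
  refine Prod.ext ?_ (trackEquiv.injective h.2)
  simpa [Nat.mod_eq_of_lt (Nat.lt_succ_of_le hq), Nat.mod_eq_of_lt (Nat.lt_succ_of_le hq')]
    using h.1

/-- A transition up to the choice of a round, which turns the places into indices. -/
abbrev Template (Λ : Type) : Type :=
  (Place × Track Λ) × Option Λ × (Place × Track Λ)

open Classical in
/-- The list of all transitions of one kind. -/
noncomputable def rules (T : TraceSystem Λ) (ph : Phase) : List (Template Λ) :=
  (Finset.univ.filter fun t : Template Λ => T.Rule ph t.1 t.2.1 t.2.2).toList

theorem mem_rules {T : TraceSystem Λ} {ph : Phase} {t : Template Λ} :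
    t ∈ T.rules ph ↔ T.Rule ph t.1 t.2.1 t.2.2 := by
  simp [rules]

/-- The numbered transition that `t` stands for in round `j`. -/
noncomputable def transition (S j : ℕ) (t : Template Λ) :
    Fin ((S + 1) * numTracks Λ) × Fin (Fintype.card (Option Λ)) × Fin ((S + 1) * numTracks Λ) :=
  (stateCode S (loc j t.1), letterEquiv t.2.1, stateCode S (loc j t.2.2))

/-- The automaton `nfa` as a finite object. -/
noncomputable abbrev fsa (T : TraceSystem Λ) (S : ℕ) (x : List Bool) : FSA where
  letters := Fintype.card (Option Λ)
  letters_pos := Fintype.card_pos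
  states := (S + 1) * numTracks Λ
  initial := [(0, Track.free), (0, .win1 T.first), (0, .noacc), (0, .initWall)].map (stateCode S)
  final := [(0, Track.top), (S, .count)].map (stateCode S)
  trans := (T.rules .hub).map (transition S 0) ++ (T.rules .last).map (transition S S) ++
    (List.range S).reverse.flatMap fun j => (T.rules (.round x[j]?)).map (transition S j)

variable {T : TraceSystem Λ} {S : ℕ} {x : List Bool}

theorem loc_fst_le {Λ : Type} {T : TraceSystem Λ} (hS : 1 ≤ S) {ph : Phase} {j : ℕ}
    {r r' : Place × Track Λ} {a : Option Λ} (hat : ph.At S x j) (h : T.Rule ph r a r') :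
    (loc j r).1 ≤ S ∧ (loc j r').1 ≤ S := by
  cases h <;> simp only [Phase.At] at hat <;> simp only [loc, Place.pos] <;> omega

theorem mem_trans_iff {t} : t ∈ (T.fsa S x).trans ↔
    ∃ q a q', q' ∈ (T.nfa S x).step q a ∧ t = (stateCode S q, letterEquiv a, stateCode S q') := by
  constructor
  · intro h
    simp only [fsa, List.mem_append, List.mem_map, List.mem_flatMap, mem_rules, List.mem_reverse,
      List.mem_range] at h
    rcases h with (⟨t, h, rfl⟩ | ⟨t, h, rfl⟩) | ⟨j, hj, t, h, rfl⟩
    · exact ⟨_, _, _, ⟨.hub, 0, _, _, rfl, h, rfl, rfl⟩, rfl⟩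
    · exact ⟨_, _, _, ⟨.last, S, _, _, rfl, h, rfl, rfl⟩, rfl⟩
    · exact ⟨_, _, _, ⟨.round x[j]?, j, _, _, ⟨hj, rfl⟩, h, rfl, rfl⟩, rfl⟩
  · rintro ⟨_, a, _, ⟨ph, j, r, r', hat, hr, rfl, rfl⟩, rfl⟩
    simp only [fsa, List.mem_append, List.mem_map, List.mem_flatMap, mem_rules, List.mem_reverse,
      List.mem_range]
    cases ph with
    | hub =>
      obtain rfl : j = 0 := hat
      exact Or.inl (Or.inl ⟨(r, a, r'), hr, rfl⟩)
    | last =>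
      obtain rfl : j = S := hat
      exact Or.inl (Or.inr ⟨(r, a, r'), hr, rfl⟩)
    | round o =>
      obtain ⟨hj, rfl⟩ := hat
      exact Or.inr ⟨j, hj, (r, a, r'), hr, rfl⟩

theorem fst_le_of_mem_eval {Λ : Type} {T : TraceSystem Λ} (hS : 1 ≤ S) {w : List (Option Λ)}
    {q : ℕ × Track Λ} (h : q ∈ (T.nfa S x).eval w) : q.1 ≤ S := by
  rcases List.eq_nil_or_concat w with rfl | ⟨w, a, rfl⟩
  · have h : q ∈ [(0, Track.free), (0, .win1 T.first), (0, .noacc), (0, .initWall)] := h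
    simp only [List.mem_cons, List.not_mem_nil, or_false] at h
    rcases h with rfl | rfl | rfl | rfl <;> simp
  · rw [List.concat_eq_append] at h
    obtain ⟨_, -, ph, j, r, r', hat, hr, -, rfl⟩ := exists_of_mem_eval_append h
    exact (loc_fst_le hS hat hr).2

theorem eval_fsa (hS : 1 ≤ S) (w : List (Option Λ)) :
    (T.fsa S x).toNFA.eval (w.map letterEquiv) = stateCode S '' (T.nfa S x).eval w := by
  induction w using List.reverseRecOn with
  | nil =>
    ext q
    change q ∈ List.map _ _ ↔ _
    rw [List.mem_map]
    rfl
  | append_singleton w a ih =>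
    rw [List.map_append, List.map_singleton, NFA.eval_append_singleton, ih,
      NFA.eval_append_singleton]
    ext q'
    rw [NFA.mem_stepSet]
    constructor
    · rintro ⟨_, ⟨q, hq, rfl⟩, h⟩
      obtain ⟨q₁, a₁, q₁', h₁, he⟩ := mem_trans_iff.1
        (show (stateCode S q, letterEquiv a, q') ∈ (T.fsa S x).trans from h)
      simp only [Prod.mk.injEq, EmbeddingLike.apply_eq_iff_eq] at he
      obtain ⟨h1, rfl, rfl⟩ := he
      have hq₁ : q₁.1 ≤ S := by
        obtain ⟨ph, j, r, r', hat, hr, rfl, -⟩ := h₁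
        exact (loc_fst_le hS hat hr).1
      obtain rfl := stateCode_inj (fst_le_of_mem_eval hS hq) hq₁ h1
      exact ⟨q₁', NFA.mem_stepSet.2 ⟨q, hq, h₁⟩, rfl⟩
    · rintro ⟨q', h, rfl⟩
      obtain ⟨q, hq, h⟩ := NFA.mem_stepSet.1 h
      exact ⟨_, ⟨q, hq, rfl⟩, mem_trans_iff.2 ⟨q, a, q', h, rfl⟩⟩

theorem map_mem_language (hS : 1 ≤ S) (w : List (Option Λ)) :
    w.map letterEquiv ∈ (T.fsa S x).language ↔ w ∈ (T.nfa S x).accepts := by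
  constructor
  · rintro ⟨q, hq, h⟩
    have h : q ∈ (T.fsa S x).toNFA.eval (w.map letterEquiv) := h
    rw [eval_fsa hS] at h
    obtain ⟨q, hqw, rfl⟩ := h
    obtain ⟨q', hq', he⟩ := List.mem_map.1 (show stateCode S q ∈ List.map _ _ from hq)
    have hq'' : q'.1 ≤ S := by
      simp only [List.mem_cons, List.not_mem_nil, or_false] at hq'
      rcases hq' with rfl | rfl <;> simp
    obtain rfl := stateCode_inj hq'' (fst_le_of_mem_eval hS hqw) he
    exact ⟨q', hq', hqw⟩
  · rintro ⟨q, hq, h⟩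
    refine ⟨stateCode S q, List.mem_map_of_mem (f := stateCode S) hq, ?_⟩
    change stateCode S q ∈ (T.fsa S x).toNFA.eval (w.map letterEquiv)
    rw [eval_fsa hS]
    exact ⟨q, h, rfl⟩

/-! ### The state complexity -/

theorem stateComplexity_le_two {V : ℕ → Λ} (hS : 1 ≤ S) (hV : T.IsTrace S x V)
    (hacc : ∀ i, ¬ T.acc (V (i + 1))) : (T.fsa S x).stateComplexity ≤ 2 := by
  -- Two states record whether the separator has been read.
  let D : DFA (Fin (T.fsa S x).letters) Bool :=
    { step := fun b a => b || (letterEquiv.symm a : Option Λ).isNone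
      start := false
      accept := {true} }
  have hD : ∀ w : List (Option Λ), D.eval (w.map letterEquiv) = true ↔ none ∈ w := by
    intro w
    induction w using List.reverseRecOn with
    | nil => simp [D]
    | append_singleton w a ih =>
      rw [List.map_append, List.map_singleton, DFA.eval_append_singleton, List.mem_append, ← ih]
      change (D.eval _ || (letterEquiv.symm (letterEquiv a)).isNone) = true ↔ _
      rw [Equiv.symm_apply_apply, Bool.or_eq_true, Option.isNone_iff_eq_none, List.mem_singleton,
        eq_comm (a := a)]
  refine (FSA.isLeast_stateComplexity _).2 ⟨DFA.reindex finTwoEquiv.symm D, ?_⟩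
  rw [DFA.accepts_reindex]
  ext w
  obtain ⟨w, rfl⟩ : ∃ w' : List (Option Λ), w = w'.map letterEquiv :=
    ⟨w.map letterEquiv.symm, by simp [Function.comp_def]⟩
  rw [map_mem_language hS, mem_accepts_of_not_acc hS hV hacc, ← hD]
  rfl

theorem two_pow_le_stateComplexity {V : ℕ → Λ} (hS : 1 ≤ S) (hV : T.IsTrace S x V) {i : ℕ}
    (hacc : T.acc (V (i + 1))) : 2 ^ (S + 1) ≤ (T.fsa S x).stateComplexity := by
  obtain ⟨D, hD⟩ := (FSA.isLeast_stateComplexity (T.fsa S x)).1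
  have h := two_pow_le_card hS hV hacc (D.comap letterEquiv) (by
    rw [DFA.accepts_comap, hD]
    ext w
    exact map_mem_language hS w)
  simpa using h

/-! ### The code of the automaton -/

theorem expand_append (C j : ℕ) (v w : List (Option Bool)) :
    expand C j (v ++ w) = expand C j v ++ expand C j w :=
  List.flatMap_append

theorem expand_cons_some (C j : ℕ) (b : Bool) (w : List (Option Bool)) :
    expand C j (some b :: w) = b :: expand C j w :=
  rfl

theorem expand_cons_none (C j : ℕ) (w : List (Option Bool)) :
    expand C j (none :: w) = ones (C * j) ++ expand C j w :=
  rfl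

theorem expand_map_some (C j : ℕ) (w : List Bool) : expand C j (w.map some) = w := by
  induction w with
  | nil => rfl
  | cons b w ih => simpa [expand] using ih

theorem expand_flatMap {β : Type} (C j : ℕ) (l : List β) (e : β → List (Option Bool)) :
    expand C j (l.flatMap e) = l.flatMap fun b => expand C j (e b) :=
  List.flatMap_assoc

/-- In the code of a state, the part that depends on the index comes first, as a block of ones. -/
theorem encodeUnary_add (m n : ℕ) : FSA.encodeUnary (m + n) = ones n ++ FSA.encodeUnary m := by
  rw [FSA.encodeUnary, FSA.encodeUnary, Nat.add_comm, List.replicate_add, List.append_assoc]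

/-- The template for an index. -/
def placeTemplate (C : ℕ) : Place → List (Option Bool)
  | .zero => []
  | .one => (ones C).map some
  | .cur => [none]
  | .succ => none :: (ones C).map some

theorem expand_placeTemplate (C j : ℕ) (P : Place) :
    expand C j (placeTemplate C P) = ones (C * P.pos j) := by
  cases P
  · rfl
  · rw [placeTemplate, expand_map_some, Place.pos, Nat.mul_one]
  · simp [placeTemplate, expand, Place.pos]
  · rw [placeTemplate, expand_cons_none, expand_map_some, Place.pos, Nat.mul_succ,
      List.replicate_append_replicate]

/-- The template for a state. -/
noncomputable def stateTemplate (r : Place × Track Λ) : List (Option Bool) :=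
  placeTemplate (numTracks Λ) r.1 ++ (FSA.encodeUnary (trackEquiv r.2)).map some

theorem expand_stateTemplate {j : ℕ} {r : Place × Track Λ} (hr : (loc j r).1 ≤ S) :
    expand (numTracks Λ) j (stateTemplate r) = FSA.encodeFin (stateCode S (loc j r)) := by
  rw [stateTemplate, expand_append, expand_placeTemplate, expand_map_some, FSA.encodeFin,
    val_stateCode hr, encodeUnary_add]
  rfl

/-- The template for an entry of the list of transitions. -/
noncomputable def entryTemplate (t : Template Λ) : List (Option Bool) :=
  some true :: (stateTemplate t.1 ++ (FSA.encodeFin (letterEquiv t.2.1)).map some ++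
    stateTemplate t.2.2)

theorem expand_rules (hS : 1 ≤ S) {ph : Phase} {j : ℕ} (hat : ph.At S x j) :
    expand (numTracks Λ) j ((T.rules ph).flatMap entryTemplate) =
      ((T.rules ph).map (transition S j)).flatMap fun t => true :: FSA.encodeTransition t := by
  rw [expand_flatMap, List.flatMap_map]
  refine List.flatMap_congr fun t ht => ?_
  obtain ⟨h1, h2⟩ := loc_fst_le hS hat (mem_rules.1 ht)
  rw [entryTemplate, expand_cons_some, expand_append, expand_append,
    expand_stateTemplate h1, expand_stateTemplate h2, expand_map_some]
  rfl

/-- The template for a list of states. -/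
noncomputable def statesTemplate (l : List (Place × Track Λ)) : List (Option Bool) :=
  (l.flatMap fun r => some true :: stateTemplate r) ++ [some false]

theorem expand_statesTemplate {j : ℕ} {l : List (Place × Track Λ)}
    (hl : ∀ r ∈ l, (loc j r).1 ≤ S) :
    expand (numTracks Λ) j (statesTemplate l) =
      FSA.encodeList FSA.encodeFin ((l.map (loc j)).map (stateCode S)) := by
  rw [statesTemplate, expand_append, expand_flatMap, FSA.encodeList, List.map_map,
    List.flatMap_map]
  congr 1
  refine List.flatMap_congr fun r hr => ?_
  rw [expand_cons_some, expand_stateTemplate (hl r hr)]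
  rfl

/-- The template for the part of the code that does not depend on the input. -/
noncomputable def headTemplate (T : TraceSystem Λ) : List (Option Bool) :=
  (FSA.encodeUnary (Fintype.card (Option Λ))).map some ++
    (none :: (FSA.encodeUnary (numTracks Λ)).map some) ++
    statesTemplate (Λ := Λ)
      [(.zero, .free), (.zero, .win1 T.first), (.zero, .noacc), (.zero, .initWall)] ++
    statesTemplate (Λ := Λ) [(.zero, .top), (.cur, .count)] ++
    (T.rules .hub).flatMap entryTemplate ++ (T.rules .last).flatMap entryTemplate

/-- The code of the automaton is a word that the printing program produces. -/
theorem encode_fsa (hS : 1 ≤ S) : (T.fsa S x).encode =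
    printed (numTracks Λ) T.headTemplate (fun o => (T.rules (.round o)).flatMap entryTemplate)
      S x := by
  have h0 : expand (numTracks Λ) S ((T.rules .hub).flatMap entryTemplate) =
      ((T.rules .hub).map (transition S 0)).flatMap fun t => true :: FSA.encodeTransition t := by
    rw [← expand_rules (x := x) hS (show Phase.hub.At S x 0 from rfl), expand_flatMap,
      expand_flatMap]
    -- Transitions between the indices `0` and `1` look the same in all rounds.
    refine List.flatMap_congr fun t ht => ?_
    have h := mem_rules.1 ht
    obtain ⟨⟨P, t⟩, a, P', t'⟩ := t
    have hP : ∀ P : Place, P = .zero ∨ P = .one →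
        expand (numTracks Λ) S (placeTemplate (numTracks Λ) P) =
          expand (numTracks Λ) 0 (placeTemplate (numTracks Λ) P) := by
      rintro P (rfl | rfl) <;> rw [expand_placeTemplate, expand_placeTemplate] <;> rfl
    have h1 : P = .zero ∨ P = .one := by cases h <;> simp
    have h2 : P' = .zero ∨ P' = .one := by cases h <;> simp
    simp only [entryTemplate, stateTemplate]
    simp only [expand_cons_some, expand_append, hP P h1, hP P' h2, expand_map_some]
  have hr : ∀ j ∈ (List.range S).reverse,
      expand (numTracks Λ) j ((T.rules (.round x[j]?)).flatMap entryTemplate) =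
        ((T.rules (.round x[j]?)).map (transition S j)).flatMap
          fun t => true :: FSA.encodeTransition t := by
    intro j hj
    have hj : j < S := by simpa using hj
    exact expand_rules (x := x) hS ⟨hj, rfl⟩
  rw [printed, List.flatMap_congr hr, headTemplate]
  simp only [expand_append]
  rw [h0, expand_rules (x := x) hS (show Phase.last.At S x S from rfl),
    expand_statesTemplate (S := S) (Λ := Λ) (by simp [loc, Place.pos]),
    expand_statesTemplate (S := S) (Λ := Λ) (by simp [loc, Place.pos]), expand_map_some,
    expand_cons_none, expand_map_some]
  have hs : FSA.encodeUnary (T.fsa S x).states =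
      ones (numTracks Λ * S) ++ FSA.encodeUnary (numTracks Λ) := by
    rw [← encodeUnary_add]
    congr 1
    change (S + 1) * numTracks Λ = _
    ring
  have ht : FSA.encodeList FSA.encodeTransition (T.fsa S x).trans =
      (T.fsa S x).trans.flatMap (fun t => true :: FSA.encodeTransition t) ++ [false] := rfl
  rw [FSA.encode, hs, ht]
  simp only [fsa, List.flatMap_append, List.flatMap_assoc, List.append_assoc]
  rfl

end TraceSystem

/-! ### Comparing the length of a binary number with that of a word -/

theorem lt_two_pow_length_encodePosNum (n : PosNum) :
    (n : ℕ) < 2 ^ (Computability.encodePosNum n).length := by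
  induction n with
  | one => simp [Computability.encodePosNum]
  | bit0 n ih =>
    simp only [Computability.encodePosNum, List.length_cons, pow_succ, PosNum.cast_bit0]
    omega
  | bit1 n ih =>
    simp only [Computability.encodePosNum, List.length_cons, pow_succ, PosNum.cast_bit1]
    omega

theorem two_pow_length_encodePosNum_le (n : PosNum) :
    2 ^ (Computability.encodePosNum n).length ≤ 2 * (n : ℕ) := by
  induction n with
  | one => simp [Computability.encodePosNum]
  | bit0 n ih =>
    simp only [Computability.encodePosNum, List.length_cons, pow_succ, PosNum.cast_bit0]
    omega
  | bit1 n ih =>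
    simp only [Computability.encodePosNum, List.length_cons, pow_succ, PosNum.cast_bit1]
    omega

theorem lt_length_encodeNat_iff (k m : ℕ) :
    k < (Computability.encodeNat m).length ↔ 2 ^ k ≤ m := by
  rw [Computability.encodeNat]
  have hm : ((m : Num) : ℕ) = m := Num.to_of_nat m
  generalize (m : Num) = a at hm
  cases a with
  | zero =>
    obtain rfl : m = 0 := by simpa using hm.symm
    simp [Computability.encodeNum]
  | pos n =>
    have h1 := lt_two_pow_length_encodePosNum n
    have h2 := two_pow_length_encodePosNum_le n
    rw [Num.cast_pos] at hm
    rw [hm] at h1 h2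
    change k < (Computability.encodePosNum n).length ↔ _
    constructor
    · intro h
      have := Nat.pow_le_pow_right (show 0 < 2 by norm_num) (Nat.succ_le_of_lt h)
      rw [Nat.pow_succ] at this
      omega
    · intro h
      exact (Nat.pow_lt_pow_iff_right (by norm_num)).1 (h.trans_lt h1)

namespace StackProg

/-- The stacks of the comparison program. -/
inductive CmpStk
  | inp
  | left
  | right
  | out
  deriving DecidableEq

instance : Fintype CmpStk :=
  ⟨{.inp, .left, .right, .out}, by rintro (_ | _ | _ | _) <;> simp⟩

/-- The alphabets of the comparison program. The input has a separator. -/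
abbrev CmpSym : CmpStk → Type
  | .inp => Option Bool
  | _ => Bool

/-- How the comparison program stores symbols in its register. -/
def cmpRead : ∀ k, CmpSym k → Option Bool
  | .inp, a => a
  | .left, a => some a
  | .right, a => some a
  | .out, a => some a

/-- The contents of the stacks of the comparison program: the input, two numbers in unary, and the
output. -/
def cmpStore (l : List (Option Bool)) (m n : ℕ) (o : List Bool) : ∀ k, List (CmpSym k)
  | .inp => l
  | .left => ones m
  | .right => ones n
  | .out => o

theorem update_cmpStore_inp (l l' : List (Option Bool)) (m n : ℕ) (o : List Bool) :
    Function.update (cmpStore l m n o) .inp l' = cmpStore l' m n o := by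
  funext k
  cases k <;> rfl

theorem update_cmpStore_left (l : List (Option Bool)) (m m' n : ℕ) (o : List Bool) :
    Function.update (cmpStore l m n o) .left (ones m') = cmpStore l m' n o := by
  funext k
  cases k <;> rfl

theorem update_cmpStore_right (l : List (Option Bool)) (m n n' : ℕ) (o : List Bool) :
    Function.update (cmpStore l m n o) .right (ones n') = cmpStore l m n' o := by
  funext k
  cases k <;> rfl

theorem update_cmpStore_out (l : List (Option Bool)) (m n : ℕ) (o o' : List Bool) :
    Function.update (cmpStore l m n o) .out o' = cmpStore l m n o' := by
  funext k
  cases k <;> rfl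

/-- Programs on the stacks `CmpStk`. -/
abbrev CmpProg : Type := StackProg CmpSym (Option Bool)

/-- Count the letters before the separator on the stack `left` and those behind it on the stack
`right`. The stack `right` counts at first; the separator makes its content move to `left`. -/
def splitProg : CmpProg :=
  loop .inp (ite (fun v => v == some none)
    (loop .right (push .left fun _ => true))
    (push .right fun _ => true))

/-- The round of `splitProg` in which the separator is read. -/
theorem runs_move (l : List (Option Bool)) (n : ℕ) (v : Option (Option Bool)) :
    Runs cmpRead (loop .right (push .left fun _ => true)) v (cmpStore l 0 n [])
      (cmpStore l n 0 []) (n + 1) := by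
  have h := Runs.loop_rounds (rd := cmpRead) (k := CmpStk.right) (l := ones n) (t := 0) (v := v)
    (p := push .left fun _ => true) (fun i => cmpStore l i (n - i) [])
    (by intro i _; exact (List.drop_replicate (a := true)).symm)
    (by
      intro i hi
      refine (Runs.push _).congr rfl ?_ le_rfl
      rw [show (ones n).drop (i + 1) = ones (n - (i + 1)) from List.drop_replicate]
      funext k
      cases k <;> rfl)
  exact h.congr rfl (by simp) (by simp)

theorem runs_splitProg (x b : List Bool) (v : Option (Option Bool)) :
    Runs cmpRead splitProg v (cmpStore (x.map some ++ none :: b.map some) 0 0 [])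
      (cmpStore [] x.length b.length []) ((x.length + 1 + b.length) * (x.length + 2) + 1) := by
  have hlen : (x.map some ++ none :: b.map some).length = x.length + 1 + b.length := by
    simp
    omega
  have h := Runs.loop_rounds (rd := cmpRead) (k := CmpStk.inp)
    (l := (x.map some ++ none :: b.map some : List (Option Bool))) (t := x.length + 1) (v := v)
    (p := ite (fun v => v == some none)
      (loop .right (push .left fun _ => true)) (push .right fun _ => true))
    (fun i => cmpStore ((x.map some ++ none :: b.map some).drop i)
      (if i ≤ x.length then 0 else x.length) (if i ≤ x.length then i else i - (x.length + 1)) [])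
    (by intro i _; rfl)
    (by
      intro i hi
      rw [update_cmpStore_inp]
      apply Runs.ite
      rcases lt_trichotomy i x.length with hix | rfl | hix
      · have e : (x.map some ++ none :: b.map some)[i] = some x[i] := by
          rw [List.getElem_append_left (by simpa using hix), List.getElem_map]
        rw [e, if_pos hix.le, if_pos hix.le, if_pos (Nat.succ_le_of_lt hix),
          if_pos (Nat.succ_le_of_lt hix)]
        refine (Runs.push (rd := cmpRead) (k := .right) _).congr rfl ?_ (Nat.zero_le _)
        exact update_cmpStore_right _ _ _ (i + 1) _
      · have e : (x.map some ++ none :: b.map some)[x.length] = none := by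
          rw [List.getElem_append_right (by simp)]
          simp
        rw [e]
        simpa [cmpRead] using runs_move _ _ _
      · have e : ∃ c, (x.map some ++ none :: b.map some)[i] = some c := by
          obtain ⟨j, rfl⟩ : ∃ j, i = x.length + 1 + j := ⟨i - (x.length + 1), by omega⟩
          have hj : j < b.length := by omega
          refine ⟨b[j], ?_⟩
          rw [List.getElem_append_right (by simp; omega)]
          simp [show x.length + 1 + j - x.length = j + 1 by omega]
        obtain ⟨c, e⟩ := e
        rw [e, if_neg (by omega), if_neg (by omega), if_neg (by omega), if_neg (by omega)]
        refine (Runs.push (rd := cmpRead) (k := .right) _).congr rfl ?_ (Nat.zero_le _)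
        rw [show i + 1 - (x.length + 1) = (i - (x.length + 1)) + 1 by omega]
        exact update_cmpStore_right _ _ _ (i - (x.length + 1) + 1) _)
  refine h.congr ?_ ?_ ?_
  · simp
  · rw [hlen]
    rw [if_neg (by omega), if_neg (by omega), List.drop_eq_nil_of_le hlen.le]
    congr 1
    omega
  · rw [hlen]

/-- Push `c` letters on the stack `left`. -/
def padProg : ℕ → CmpProg
  | 0 => skip
  | c + 1 => seq (padProg c) (push .left fun _ => true)

theorem runs_padProg (c m n : ℕ) (v : Option (Option Bool)) :
    Runs cmpRead (padProg c) v (cmpStore [] m n []) (cmpStore [] (m + c) n []) 0 := by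
  induction c generalizing v with
  | zero => exact Runs.skip
  | succ c ih =>
    refine (Runs.seq (ih v) fun v => Runs.push (k := CmpStk.left) (v := v) _).congr rfl ?_ le_rfl
    exact update_cmpStore_left _ _ (m + c + 1) _ _

theorem runs_subtract (m n : ℕ) (v : Option (Option Bool)) :
    Runs cmpRead (loop .left (pop .right skip)) v (cmpStore [] m n [])
      (cmpStore [] 0 (n - m) []) (m + 1) := by
  have h := Runs.loop_rounds (rd := cmpRead) (k := CmpStk.left) (l := ones m) (t := 0) (v := v)
    (p := pop .right skip) (fun i => cmpStore [] (m - i) (n - i) [])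
    (by intro i _; exact (List.drop_replicate (a := true)).symm)
    (by
      intro i hi
      rw [show (ones m).drop (i + 1) = ones (m - (i + 1)) from List.drop_replicate,
        update_cmpStore_left]
      refine Runs.pop (Runs.skip.congr ?_ rfl le_rfl)
      rw [show (cmpStore [] (m - (i + 1)) (n - i) [] .right).tail = ones (n - (i + 1)) from
        List.tail_replicate, update_cmpStore_right])
  exact h.congr rfl (by simp) (by simp)

theorem runs_clear (m n : ℕ) (o : List Bool) (v : Option (Option Bool)) :
    Runs cmpRead (loop .right skip) v (cmpStore [] m n o) (cmpStore [] m 0 o) (n + 1) := by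
  have h := Runs.loop_rounds (rd := cmpRead) (k := CmpStk.right) (l := ones n) (t := 0) (v := v)
    (p := skip) (fun i => cmpStore [] m (n - i) o)
    (by intro i _; exact (List.drop_replicate (a := true)).symm)
    (by
      intro i hi
      rw [show (ones n).drop (i + 1) = ones (n - (i + 1)) from List.drop_replicate,
        update_cmpStore_right]
      exact Runs.skip)
  exact h.congr rfl (by simp) (by simp)

/-- Decide whether the number of letters behind the separator exceeds the number of letters before
it by more than `c`. -/
def cmpProg (c : ℕ) : CmpProg :=
  seq splitProg <| seq (padProg c) <| seq (loop .left (pop .right skip)) <|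
    seq (pop .right (push .out fun v => v.isSome)) (loop .right skip)

theorem runs_cmpProg (c : ℕ) (x b : List Bool) (v : Option (Option Bool)) :
    Runs cmpRead (cmpProg c) v (cmpStore (x.map some ++ none :: b.map some) 0 0 [])
      (cmpStore [] 0 0 [decide (x.length + c < b.length)])
      ((x.length + 1 + b.length) * (x.length + 2) + 1 +
        (0 + ((x.length + c + 1) + (0 + (b.length + 1))))) := by
  refine Runs.seq (runs_splitProg x b v) fun v => Runs.seq (runs_padProg c _ _ v) fun v =>
    Runs.seq (runs_subtract _ _ v) fun v => ?_
  refine (Runs.seq (S' := cmpStore [] 0 (b.length - (x.length + c) - 1)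
    [decide (x.length + c < b.length)]) (Runs.pop ?_) fun v => runs_clear _ _ _ v).congr rfl rfl
      (Nat.add_le_add_left (by omega) 0)
  rw [show (cmpStore [] 0 (b.length - (x.length + c)) [] .right).tail =
    ones (b.length - (x.length + c) - 1) from List.tail_replicate, update_cmpStore_right]
  refine (Runs.push _).congr rfl ?_ le_rfl
  refine Eq.trans ?_ (update_cmpStore_out _ _ _ [] _)
  congr 1
  change [_] = [_]
  congr 1
  change (Option.map _ (ones _).head?).isSome = _
  rw [Option.isSome_map]
  generalize hk : b.length - (x.length + c) = k
  cases k with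
  | zero => exact (decide_eq_false (by omega)).symm
  | succ k => exact (decide_eq_true (by omega)).symm

/-- It is decidable in polynomial time whether the number of binary digits of a number exceeds the
length of a word by more than a constant. -/
theorem computable_lt_length (c : ℕ) :
    Nonempty (Turing.TM2ComputableInPolyTime encodeWordNat Computability.encodeBool
      fun a => decide (a.1.length + c < (Computability.encodeNat a.2).length)) := by
  refine computableInPolyTime (A := Option Bool) (B := Bool) cmpRead (cmpProg c) .inp .out
    (Γ := CmpSym) (hΓ := inferInstanceAs (Fintype (Option Bool)))
    (Equiv.refl _) (Equiv.refl _)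
    (Polynomial.X * (Polynomial.X + 2) + 1 +
      (0 + ((Polynomial.X + Polynomial.C c + 1) + (0 + (Polynomial.X + 1))))) ?_
  rintro ⟨x, m⟩
  refine (runs_cmpProg c x (Computability.encodeNat m) none).congr ?_ ?_ ?_
  · funext k
    cases k <;> simp [cmpStore, encodeWordNat]
  · funext k
    cases k <;> simp [cmpStore, Computability.encodeBool]
  · have hl : (encodeWordNat (x, m)).length =
        x.length + 1 + (Computability.encodeNat m).length := by
      simp [encodeWordNat]
      omega
    rw [hl]
    simp only [Polynomial.eval_add, Polynomial.eval_mul, Polynomial.eval_X, Polynomial.eval_C,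
      Polynomial.eval_one, Polynomial.eval_ofNat, Polynomial.eval_zero]
    gcongr <;> omega

end StackProg

/-! ### Growth of polynomials -/

theorem Polynomial.eval_nat_le_eval (P : Polynomial ℕ) {m n : ℕ} (h : m ≤ n) :
    P.eval m ≤ P.eval n := by
  rw [Polynomial.eval_eq_sum_range, Polynomial.eval_eq_sum_range]
  gcongr

theorem exists_nat_polynomial_bound (p : Polynomial ℝ) (f : ℕ → ℕ)
    (hpf : ∀ i : ℕ, (f i : ℝ) = p.eval (i : ℝ)) : ∃ Q : Polynomial ℕ, ∀ i, f i ≤ Q.eval i := by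
  refine ⟨∑ k ∈ Finset.range (p.natDegree + 1), Polynomial.monomial k ⌈|p.coeff k|⌉₊, fun i => ?_⟩
  have h : (f i : ℝ) ≤
      ((∑ k ∈ Finset.range (p.natDegree + 1), ⌈|p.coeff k|⌉₊ * i ^ k : ℕ) : ℝ) := by
    rw [hpf, Polynomial.eval_eq_sum_range]
    push_cast
    gcongr with k
    exact (le_abs_self _).trans (Nat.le_ceil _)
  simpa [Polynomial.eval_finsetSum] using (Nat.cast_le (α := ℝ)).1 h

theorem eval_isLittleO_two_pow (P : Polynomial ℕ) :
    (fun n : ℕ => ((P.eval n : ℕ) : ℝ)) =o[Filter.atTop] fun n : ℕ => (2 : ℝ) ^ n := by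
  induction P using Polynomial.induction_on' with
  | add p q hp hq => simpa using hp.add hq
  | monomial k a =>
    have h := isLittleO_pow_const_const_pow_of_one_lt (R := ℝ) k (r := 2) (by norm_num)
    simpa using h.const_mul_left (a : ℝ)

theorem exists_eval_lt_two_pow (P : Polynomial ℕ) : ∃ c, ∀ n ≥ c, P.eval n < 2 ^ n := by
  obtain ⟨c, hc⟩ := Filter.eventually_atTop.1
    ((eval_isLittleO_two_pow P).bound (show (0 : ℝ) < 1 / 2 by norm_num))
  refine ⟨c, fun n hn => ?_⟩
  have h := hc n hn
  rw [Real.norm_of_nonneg (by positivity), Real.norm_of_nonneg (by positivity)] at h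
  have h2 : (0 : ℝ) < 2 ^ n := by positivity
  have h' : ((P.eval n : ℕ) : ℝ) < ((2 ^ n : ℕ) : ℝ) := by
    push_cast
    linarith
  exact_mod_cast h'

/-- Every polynomial is bounded by a power, if the argument of the power is a bit larger. -/
theorem exists_eval_le_pow (P : Polynomial ℕ) :
    ∃ d, 1 ≤ d ∧ ∀ n m, n + 2 ≤ m → P.eval n ≤ m ^ d := by
  induction P using Polynomial.induction_on' with
  | add p q hp hq =>
    obtain ⟨d, hd, h⟩ := hp
    obtain ⟨e, he, h'⟩ := hq
    refine ⟨max d e + 1, by omega, fun n m hm => ?_⟩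
    have h1 : m ^ d ≤ m ^ max d e := Nat.pow_le_pow_right (by omega) (le_max_left _ _)
    have h2 : m ^ e ≤ m ^ max d e := Nat.pow_le_pow_right (by omega) (le_max_right _ _)
    calc (p + q).eval n = p.eval n + q.eval n := Polynomial.eval_add
      _ ≤ m ^ max d e + m ^ max d e :=
        Nat.add_le_add ((h n m hm).trans h1) ((h' n m hm).trans h2)
      _ = m ^ max d e * 2 := by ring
      _ ≤ m ^ (max d e + 1) := by
        rw [pow_succ]
        exact Nat.mul_le_mul_left _ (by omega)
  | monomial k a =>
    refine ⟨a + k + 1, by omega, fun n m hm => ?_⟩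
    rw [Polynomial.eval_monomial]
    calc a * n ^ k ≤ m ^ a * m ^ k := by
          refine Nat.mul_le_mul ?_ (Nat.pow_le_pow_left (by omega) k)
          exact Nat.lt_two_pow_self.le.trans (Nat.pow_le_pow_left (by omega) a)
      _ = m ^ (a + k) := by rw [pow_add]
      _ ≤ m ^ (a + k + 1) := Nat.pow_le_pow_right (by omega) (by omega)

/-! ### The reduction -/

/-- For every language in PSPACE there is a polynomial-time reduction to automata whose state
complexity is at most `2` for words outside the language and exponential for words in it. The
exponential lower bound exceeds any given polynomial of the number of states. -/
theorem exists_reduction {L : Language Bool} (hL : InPSPACE L) {f : ℕ → ℕ} {Q : Polynomial ℕ}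
    (hQ : ∀ i, f i ≤ Q.eval i) :
    ∃ (r : List Bool → FSA) (c : ℕ),
      Nonempty (Turing.TM2ComputableInPolyTime (id : List Bool → List Bool) FSA.encode r) ∧
      ∀ x : List Bool,
        (x ∈ L → 2 ^ (x.length + c) ≤ (r x).stateComplexity) ∧
        (x ∉ L → (r x).stateComplexity ≤ 2) ∧
        2 ≤ (r x).states ∧
        ∀ k ≤ 2 + (r x).states, f k < 2 ^ (x.length + c) := by
  classical
  obtain ⟨M, s, hM⟩ := hL
  let _ := M.stateFintype
  let _ := M.symbolFintype
  let T := M.traceSystem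
  let C := TraceSystem.numTracks M.Letter
  obtain ⟨d, hd, hs⟩ := exists_eval_le_pow s
  obtain ⟨c₀, hc₀⟩ := exists_eval_lt_two_pow
    (Q.comp (2 + (Polynomial.X ^ d + 1) * Polynomial.C C))
  let c := max c₀ 2
  have hpow : ∀ n, n + c ≤ (n + c) ^ d := fun n => Nat.le_self_pow (by omega) _
  have hc : 2 ≤ c := le_max_right _ _
  have hS : ∀ x : List Bool, 1 ≤ (x.length + c) ^ d := fun x => by
    have := hpow x.length
    omega
  have htrace : ∀ x : List Bool, T.IsTrace ((x.length + c) ^ d) x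
      (M.trace ((x.length + c) ^ d) x) := fun x =>
    SpaceTM.isTrace_trace fun t => ((hM x).2.2 t).trans_le (hs _ _ (by omega))
  have hacc : ∀ x : List Bool, x ∈ L ↔
      ∃ i, T.acc (M.trace ((x.length + c) ^ d) x (i + 1)) := fun x =>
    SpaceTM.mem_iff_exists_acc hM (hs _ _ (by omega))
  -- The block length has to be at least the space bound, and `c` is so large that `2 ^ (n + c)`
  -- exceeds the polynomial of the number of states, which is a polynomial of `n + c`.
  refine ⟨fun x => T.fsa ((x.length + c) ^ d) x, c, ?_, fun x => ⟨fun hx => ?_, fun hx => ?_, ?_,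
    fun k hk => ?_⟩⟩
  · obtain ⟨P, hP⟩ := StackProg.runs_printProg C T.headTemplate
      (fun o => (T.rules (.round o)).flatMap TraceSystem.entryTemplate) (c := c) (d := d)
      fun n => (Nat.le_add_right n c).trans (hpow n)
    refine StackProg.computableInPolyTime (fun _ b => b) (StackProg.printProg C T.headTemplate
      (fun o => (T.rules (.round o)).flatMap TraceSystem.entryTemplate) c d) .inp .out
      (Equiv.refl Bool) (Equiv.refl Bool) P fun x => ?_
    have h := hP x
    rw [← TraceSystem.encode_fsa (hS x)] at h
    simpa using h
  · obtain ⟨i, hi⟩ := (hacc x).1 hx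
    refine le_trans ?_ (TraceSystem.two_pow_le_stateComplexity (hS x) (htrace x) hi)
    exact Nat.pow_le_pow_right (by omega) ((hpow _).trans (Nat.le_succ _))
  · rw [hacc, not_exists] at hx
    exact TraceSystem.stateComplexity_le_two (hS x) (htrace x) hx
  · have hC : 0 < C := Fintype.card_pos_iff.2 ⟨TraceSystem.Track.free⟩
    have := hS x
    change 2 ≤ ((x.length + c) ^ d + 1) * C
    nlinarith
  · have hk : k ≤ 2 + ((x.length + c) ^ d + 1) * C := hk
    have h := hc₀ (x.length + c) (by omega)
    simp only [Polynomial.eval_comp, Polynomial.eval_add, Polynomial.eval_mul, Polynomial.eval_X,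
      Polynomial.eval_C, Polynomial.eval_one, Polynomial.eval_ofNat, Polynomial.eval_pow] at h
    exact ((hQ k).trans (Q.eval_nat_le_eval hk)).trans_lt h

theorem mainTheorem3 (p : Polynomial ℝ) (f : ℕ → ℕ)
    (hpf : ∀ i : ℕ, (f i : ℝ) = p.eval (i : ℝ)) (hf : ∀ i : ℕ, i ≤ f i) :
    PSPACEHardToCompute FSA.encode (FSA.IsApproximation FSA.stateComplexity f) ∧
    PSPACEHardToDecide FSA.encode (FSA.CausesBlowUp FSA.stateComplexity f) := by
  obtain ⟨Q, hQ⟩ := exists_nat_polynomial_bound p f hpf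
  refine ⟨fun L hL => ?_, fun L hL => ?_⟩
  · obtain ⟨r, c, hr, h⟩ := exists_reduction hL hQ
    refine ⟨r, fun a => decide (a.1.length + c < (Computability.encodeNat a.2).length), hr,
      StackProg.computable_lt_length c, fun x m hm => ?_⟩
    rw [decide_eq_true_iff, lt_length_encodeNat_iff]
    obtain ⟨h1, h2, -, h4⟩ := h x
    refine ⟨fun hx => (h1 hx).trans hm.1, fun hle => by_contra fun hx => ?_⟩
    exact absurd (hle.trans hm.2) (h4 _ (Nat.add_le_add_right (h2 hx) _)).not_ge
  · obtain ⟨r, c, hr, h⟩ := exists_reduction hL hQ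
    refine ⟨r, hr, fun x => ?_⟩
    obtain ⟨h1, h2, h3, h4⟩ := h x
    refine ⟨fun hx => (h4 _ (Nat.le_add_left _ _)).trans_le (h1 hx),
      fun hlt => by_contra fun hx => ?_⟩
    exact absurd (hlt.trans_le ((h2 hx).trans h3)) (hf _).not_gt
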